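/- Let $K$ be a differential field of characteristic zero with commuting derivations $\partial_1,\dots,\partial_n$, differentially closed: every finite system of differential polynomial equations and one inequation over $K$ that is solvable in a differential field extension of $K$ is solvable in $K$. Consider differential operators $L=\sum_v a_v\partial^v$ over $K$, with $v\in\mathbb N_0^n$ ordered componentwise. The maximal terms of $L$ are its nonzero terms $a_v\partial^v$ that are not below another nonzero term. Let $T=\{t_m\partial^m : m\in M\}$ be a finite set of terms with nonzero coefficients $t_m\in K$, $M\subset\mathbb N_0^n$ an antichain, and let $\mathcal L=\mathcal L(T)$ be the (maximally generated) class of all operators whose set of maximal terms is $T$. Let $\downarrow M=\{v: v\le m\text{ for some }m\in M\}$. A vector $v\in{\downarrow M}$ is submaximal if it is covered by an element of $M$ and every element of $\downarrow M$ covering it lies in $M$. Let $S$ be the set of submaximal vectors, $s=|S|$, and $V={\downarrow M}\setminus(M\cup S)$. For $v\in S$ let $\phi(v)=\sum_{i:\,v+e_i\in M}(v_i+1)\,t_{v+e_i}\,e_i\in K^n$. Assume that $\mathcal L$ is framed, i.e. the vectors $\phi(v)$, $v\in S$, span $K^n$, and approximately flat, i.e. there are distinct $s_1,\dots,s_n\in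 S$ with $s_i+e_i\in M$ for all $i$. For $g\in K$ write $L'=e^{-g}Le^{g}$ if $L'=w^{-1}Lw$ for a nonzero $w\in K$ with $\partial_iw=(\partial_ig)\,w$ for all $i$. An expression is a quotient of differential polynomials over $\mathbb Q$ in the coefficients $a_v$. It is defined on $\mathcal L$ if its denominator vanishes at no $L\in\mathcal L$. An invariant of $\mathcal L$ is an expression that is defined on $\mathcal L$ and takes equal values at any $L,L'\in\mathcal L$ with $L'=e^{-g}Le^{g}$ for some $g\in K$. A finite set of invariants is complete if any two $L,L'\in\mathcal L$ at which all of them have equal values satisfy $L'=e^{-g}Le^{g}$ for some $g\in K$. Then $\mathcal L$ has a complete set of invariants. More precisely, there is a complete set consisting exactly of the following invariants (equalities of values are meant at every $L\in\mathcal L$): 1. (maximal) the coefficients $a_m$, $m\in M$; 2. (extra) $s-n$ invariants with values $\sum_{v\in S}\lambda_{k,v}a_v$, where the vectors $\lambda_k=(\lambda_{k,v})_{v}\in K^S$, $1\le k\le s-n$, are linearly independent and $\sum_{v\in S}\lambda_{k,v}\phi(v)=0$; 3. (compatibility) for $1\le i<j\le n$, an invariant with value $\partial_jE_i-\partial_iE_j$,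 where $E_i=\sum_{v\in S}\mu_{i,v}a_v$ for fixed $\mu_{i,v}\in K$ with $\sum_{v\in S}\mu_{i,v}\phi(v)=e_i$; 4. (upward) for every $v\in V$, an invariant $I_v$ such that (a) $I_v$ has value $a_v-E$ for an expression $E$, defined on $\mathcal L$, in which only coefficients $a_w$ with $w>v$ or $w\in M\cup S$, and their derivatives, occur; (b) $I_v$ is a coefficient of the remainder of a generalized incomplete factorization: there are a number $r$ of parameters, a direction $d(k)\in\{1,\dots,n\}$ for each $k\le r$, for every $w\in V$ with $w>v$ a vector $f(w)\in{\downarrow M}\setminus M$ covering $w$, and for every $u\in M$ and every $w\in V$ with $w>v$ a finite sequence in $\{1,\dots,r\}$, defining ordered products $F_u(p)$ and $B_w(p)$ of factors $\partial_{d(k)}+p_k$, with $k$ running through the sequence and $p\in K^r$, in which each $\partial_i$ occurs $u_i$, respectively $f(w)_i$, times, such that for every $L\in\mathcal L$ there is exactly one $p\in K^r$ for which $$N=L-\sum_{m\in M}t_mF_m(p)-\sum_{w\in V,\,w>v}B_w(p)$$ has only terms with vectors in $V$ that are not above $v$; and the value of $I_v$ at $L$ is the coefficient of $\partial^v$ in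 this $N$. -/

import Mathlib

universe u

noncomputable section

/-- Multi-indices, ordered componentwise. -/
abbrev MIdx (n : ℕ) : Type := Fin n →₀ ℕ

/-- The standard basis vector `e_i`. -/
abbrev MIdx.e {n : ℕ} (i : Fin n) : MIdx n := Finsupp.single i 1

/-- `f_1^{v_1} ⋯ f_n^{v_n} a` for a family of self-maps `f_i`. -/
def iterApply {n : ℕ} {A : Type u} (f : Fin n → A → A) (v : MIdx n) (a : A) : A :=
  (List.finRange n).foldr (fun i b => (f i)^[v i] b) a

/-- Commuting derivations `∂_1, …, ∂_n` on a commutative ring. -/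
structure CommDerivations (n : ℕ) (K : Type u) [CommRing K] where
  d : Fin n → Derivation ℤ K K
  comm : ∀ i j a, d i (d j a) = d j (d i a)

/-- Differential operators `∑ a_v ∂^v`, given by their finitely many nonzero coefficients. -/
abbrev DiffOp (n : ℕ) (K : Type u) [Field K] : Type u := MIdx n →₀ K

namespace CommDerivations

variable {n : ℕ} {K : Type u}

/-- The iterated derivative `∂^v a`. -/
def partialD [CommRing K] (D : CommDerivations n K) (v : MIdx n) (a : K) : K :=
  iterApply (fun i b => D.d i b) v a

/-- `(K, ∂_1, …, ∂_n)` is differentially closed: every finite system of differential polynomial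
equations over `K` together with one inequation, in finitely many unknowns, that has a solution in
some differential field extension of `K` has a solution in `K`. The variable `(j, v)` stands for
`∂^v y_j`. -/
def IsDifferentiallyClosed [Field K] (D : CommDerivations n K) : Prop :=
  ∀ (m : ℕ) (P : Finset (MvPolynomial (Fin m × MIdx n) K)) (q : MvPolynomial (Fin m × MIdx n) K)
    (F : Type u) [Field F] [Algebra K F] (DF : CommDerivations n F),
    (∀ i a, DF.d i (algebraMap K F a) = algebraMap K F (D.d i a)) →
    (∃ y : Fin m → F,
      (∀ p ∈ P, MvPolynomial.aeval (fun x => DF.partialD x.2 (y x.1)) p = 0) ∧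
        MvPolynomial.aeval (fun x => DF.partialD x.2 (y x.1)) q ≠ 0) →
    ∃ y : Fin m → K,
      (∀ p ∈ P, MvPolynomial.aeval (fun x => D.partialD x.2 (y x.1)) p = 0) ∧
        MvPolynomial.aeval (fun x => D.partialD x.2 (y x.1)) q ≠ 0

variable [Field K] (D : CommDerivations n K)

/-- The product `∂_i · P`, that is `∑ (∂_i a_v) ∂^v + ∑ a_v ∂^{v + e_i}` for `P = ∑ a_v ∂^v`. -/
def mulLeftD (i : Fin n) (P : DiffOp n K) : DiffOp n K :=
  P.mapRange (D.d i) (map_zero _) + P.mapDomain (fun v => v + MIdx.e i)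

/-- The product (composition) `L · P = ∑ a_v (∂^v · P)` for `L = ∑ a_v ∂^v`. -/
def opMul (L P : DiffOp n K) : DiffOp n K :=
  L.sum fun v a => a • iterApply D.mulLeftD v P

/-- `L' = e^{-g} L e^g`. Here `e^g` is any nonzero `w ∈ K` with `∂_i w = (∂_i g) w` for all `i`
(it is unique up to a constant factor, which does not affect the conjugation), and it acts as the
multiplication operator `w`. -/
def IsGaugeTransform (g : K) (L L' : DiffOp n K) : Prop :=
  ∃ w : K, w ≠ 0 ∧ (∀ i, D.d i w = D.d i g * w) ∧
    L' = w⁻¹ • D.opMul L (Finsupp.single 0 w)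

/-- The product `∏_k (∂_{dir k} + p_k)`, over a list of parameter indices `k`. -/
def factorProd {r : ℕ} (dir : Fin r → Fin n) (p : Fin r → K) (l : List (Fin r)) : DiffOp n K :=
  l.foldr (fun k P => D.mulLeftD (dir k) P + p k • P) (Finsupp.single 0 1)

end CommDerivations

/-! ### Classes of operators given by their maximal terms -/

namespace DiffOp

variable {n : ℕ} {K : Type u} [Field K]

open Classical in
/-- The leading part of `L`: the sum of its terms that are below no other term of `L`. -/
def lead (L : DiffOp n K) : DiffOp n K :=
  L.filter fun v => Maximal (fun w => w ∈ L.support) v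

/-- A finite set `T` of terms with distinct vectors is recorded as the operator which is their sum;
`MaxGen T` is the class of all operators that have `T` as their set of maximal terms. -/
def MaxGen (T : DiffOp n K) : Set (DiffOp n K) := {L | lead L = T}

/-- No term of `T` is below another one. -/
def IsTermAntichain (T : DiffOp n K) : Prop :=
  IsAntichain (· ≤ ·) (T.support : Set (MIdx n))

/-- The vectors in the down set of `T`. -/
def downVecs (T : DiffOp n K) : Finset (MIdx n) :=
  T.support.biUnion fun m => Finset.Icc 0 m

open Classical in
/-- The submaximal vectors: covered by a maximal vector and by nothing but maximal vectors. -/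
def submaxVecs (T : DiffOp n K) : Finset (MIdx n) :=
  (downVecs T).filter fun v =>
    (∃ m ∈ T.support, v ⋖ m) ∧ ∀ w ∈ downVecs T, v ⋖ w → w ∈ T.support

open Classical in
/-- The vectors of the class that are neither maximal nor submaximal. -/
def lowVecs (T : DiffOp n K) : Finset (MIdx n) :=
  (downVecs T).filter fun v => v ∉ T.support ∧ v ∉ submaxVecs T

/-- There are distinct submaximal `s_1, …, s_n` such that every `s_i + e_i` is maximal. -/
def IsApproximatelyFlat (T : DiffOp n K) : Prop :=
  ∃ s : Fin n → MIdx n, Function.Injective s ∧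
    ∀ i, s i ∈ submaxVecs T ∧ s i + MIdx.e i ∈ T.support

/-- `φ(v) = ∑_i (v_i + 1) a_{v + e_i} e_i`, the sum over the `i` for which `v + e_i` is maximal
(for the other `i` the coefficient `T (v + e_i)` is `0`). -/
def phi (T : DiffOp n K) (v : MIdx n) : Fin n → K :=
  fun i => ((v i : K) + 1) * T (v + MIdx.e i)

/-- The vectors `φ(v)`, `v` submaximal, span `K^n`. -/
def IsFramed (T : DiffOp n K) : Prop :=
  Submodule.span K (phi T '' (submaxVecs T : Set (MIdx n))) = ⊤

end DiffOp

/-! ### Expressions in the coefficients, and invariants -/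

/-- A differential rational expression `num / den` over `ℚ` in the coefficients of an operator.
The variable `(v, w)` stands for `∂^w a_v`. -/
structure CoeffExpr (n : ℕ) where
  num : MvPolynomial (MIdx n × MIdx n) ℚ
  den : MvPolynomial (MIdx n × MIdx n) ℚ

namespace CoeffExpr

variable {n : ℕ} {K : Type u} [Field K] [CharZero K]

/-- The expression `a_v`. -/
def coeff (v : MIdx n) : CoeffExpr n := ⟨MvPolynomial.X (v, 0), 1⟩

/-- The value of a differential polynomial at the coefficients of `L`. -/
def polyValue (D : CommDerivations n K) (p : MvPolynomial (MIdx n × MIdx n) ℚ)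
    (L : DiffOp n K) : K :=
  MvPolynomial.aeval (fun x => D.partialD x.2 (L x.1)) p

/-- The value of the expression at `L`. -/
def value (D : CommDerivations n K) (I : CoeffExpr n) (L : DiffOp n K) : K :=
  polyValue D I.num L / polyValue D I.den L

/-- The denominator vanishes nowhere on the class. -/
def IsDefinedOn (D : CommDerivations n K) (I : CoeffExpr n) (𝓛 : Set (DiffOp n K)) : Prop :=
  ∀ L ∈ 𝓛, polyValue D I.den L ≠ 0

/-- Only (derivatives of) coefficients `a_w` with `w ∈ A` occur in the expression. -/
def InvolvesOnly (I : CoeffExpr n) (A : Set (MIdx n)) : Prop :=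
  ∀ x, x ∈ I.num.vars ∨ x ∈ I.den.vars → x.1 ∈ A

/-- `I` is a differential invariant of the class `𝓛`. -/
def IsInvariant (D : CommDerivations n K) (𝓛 : Set (DiffOp n K)) (I : CoeffExpr n) : Prop :=
  I.IsDefinedOn D 𝓛 ∧
    ∀ L ∈ 𝓛, ∀ L' ∈ 𝓛, (∃ g, D.IsGaugeTransform g L L') → I.value D L = I.value D L'

end CoeffExpr

section Invariants

variable {n : ℕ} {K : Type u} [Field K] [CharZero K]

/-- A complete set of invariants of `𝓛`: a finite set of invariants such that two operators in `𝓛`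
with equal values of all of them are gauge equivalent. -/
def IsCompleteSetOfInvariants (D : CommDerivations n K) (𝓛 : Set (DiffOp n K))
    (I : Set (CoeffExpr n)) : Prop :=
  I.Finite ∧ (∀ J ∈ I, J.IsInvariant D 𝓛) ∧
    ∀ L ∈ 𝓛, ∀ L' ∈ 𝓛, (∀ J ∈ I, J.value D L = J.value D L') →
      ∃ g : K, D.IsGaugeTransform g L L'

/-- The linear combination `∑ c_v a_v` of the coefficients `a_v` of `L`. -/
def coeffComb (c : MIdx n →₀ K) (L : DiffOp n K) : K := c.sum fun v b => b * L v

/-- The `I_k` are `∑_v c_{k,v} a_v`, the sums over the submaximal `v`, for linearly independent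
relations `∑_v c_{k,v} φ(v) = 0`. Under a gauge transformation `a_v` changes by `φ(v) · ∇g`, so
these relations are the ways to equate two expressions for derivatives of `g`. -/
def AreExtraInvariants (D : CommDerivations n K) (T : DiffOp n K) {ι : Type}
    (I : ι → CoeffExpr n) : Prop :=
  ∃ c : ι → MIdx n →₀ K, LinearIndependent K c ∧
    ∀ k, (c k).support ⊆ DiffOp.submaxVecs T ∧
      Finsupp.linearCombination K (DiffOp.phi T) (c k) = 0 ∧
      ∀ L ∈ DiffOp.MaxGen T, (I k).value D L = coeffComb (c k) L

/-- The `I_{ij}` are `∂_j E_i - ∂_i E_j`, where `E_i = ∑_v c_{i,v} a_v`, the sum over the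
submaximal `v`, with `∑_v c_{i,v} φ(v) = e_i`. Under a gauge transformation `E_i` changes by
`∂_i g`, so that `E_i` is an expression for the derivative `∂_i g`. -/
def AreCompatibilityInvariants (D : CommDerivations n K) (T : DiffOp n K)
    (I : Fin n → Fin n → CoeffExpr n) : Prop :=
  ∃ c : Fin n → MIdx n →₀ K,
    (∀ i, (c i).support ⊆ DiffOp.submaxVecs T ∧
      Finsupp.linearCombination K (DiffOp.phi T) (c i) = Pi.single i 1) ∧
    ∀ i j, i < j → ∀ L ∈ DiffOp.MaxGen T,
      (I i j).value D L = D.d j (coeffComb (c i) L) - D.d i (coeffComb (c j) L)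

/-- `I` is `a_v - E` on the class, where `E` is an expression that involves only coefficients above
`a_v`, maximal and submaximal coefficients, and their derivatives. -/
def IsUpwardExpr (D : CommDerivations n K) (T : DiffOp n K) (v : MIdx n)
    (I : CoeffExpr n) : Prop :=
  ∃ E : CoeffExpr n,
    E.InvolvesOnly {w | v < w ∨ w ∈ T.support ∨ w ∈ DiffOp.submaxVecs T} ∧
    E.IsDefinedOn D (DiffOp.MaxGen T) ∧
    ∀ L ∈ DiffOp.MaxGen T, I.value D L = L v - E.value D L

open Classical in
/-- The lower vectors `w` that lie above `v`. -/
def lowAbove (T : DiffOp n K) (v : MIdx n) : Finset (MIdx n) :=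
  (DiffOp.lowVecs T).filter fun w => v < w

/-- The class of remainders for `v`: the operators with terms in the down set of `T` whose
coefficients at the maximal and the submaximal vectors and at the vectors above `v` all vanish. -/
def remainderClass (T : DiffOp n K) (v : MIdx n) : Set (DiffOp n K) :=
  {N | ∀ w, N w ≠ 0 → w ∈ DiffOp.lowVecs T ∧ ¬ v < w}

/-- The shape of a generalized incomplete factorization for `v`. It has `r` parameters
`p_1, …, p_r ∈ K`, and `p_k` occurs only in first-order factors `∂_{dir k} + p_k`. There is one
product of such factors for every maximal vector `m`, in which every `∂_i` occurs `m_i` times, and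
one for every `w` above `v` that is neither maximal nor submaximal, in which every `∂_i` occurs
`(cov w)_i` times, for a nonmaximal vector `cov w` of the class that covers `w`. -/
structure FactorShape (T : DiffOp n K) (v : MIdx n) where
  r : ℕ
  dir : Fin r → Fin n
  top : MIdx n → List (Fin r)
  low : MIdx n → List (Fin r)
  cov : MIdx n → MIdx n
  top_degree : ∀ m ∈ T.support, ((top m).map fun k => MIdx.e (dir k)).sum = m
  cov_mem : ∀ w ∈ lowAbove T v, w ⋖ cov w ∧ cov w ∈ DiffOp.downVecs T ∧ cov w ∉ T.support
  low_degree : ∀ w ∈ lowAbove T v, ((low w).map fun k => MIdx.e (dir k)).sum = cov w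

/-- The operator `∑_m a_m ∏ (∂ + p) + ∑_w ∏ (∂ + p)` with the given shape and parameters. -/
def FactorShape.op (D : CommDerivations n K) {T : DiffOp n K} {v : MIdx n}
    (S : FactorShape T v) (p : Fin S.r → K) : DiffOp n K :=
  ∑ m ∈ T.support, T m • D.factorProd S.dir p (S.top m) +
    ∑ w ∈ lowAbove T v, D.factorProd S.dir p (S.low w)

/-- `I` is the coefficient of `∂^v` in the remainder of a generalized incomplete factorization:
for some shape, every `L` in the class can be written in exactly one way as an operator of that
shape plus a remainder in `remainderClass T v`, and `I` is the coefficient of `∂^v` in the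
remainder. -/
def IsFactorizationRemainder (D : CommDerivations n K) (T : DiffOp n K) (v : MIdx n)
    (I : CoeffExpr n) : Prop :=
  ∃ S : FactorShape T v, ∀ L ∈ DiffOp.MaxGen T,
    (∃! p : Fin S.r → K, L - S.op D p ∈ remainderClass T v) ∧
    ∀ p : Fin S.r → K, L - S.op D p ∈ remainderClass T v → I.value D L = (L - S.op D p) v

end Invariants

end

/-!
Gauge equivalent operators are `L` and `w⁻¹ L w`, where `∂_i w = h_i w` and `h_i = ∂_i g`.
Conjugation turns a factor `∂_i + p` into `∂_i + p + h_i` (`CommDerivations.conj_factorProd`), so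
that it fixes the maximal coefficients and adds `φ(s) · h` to a submaximal coefficient `a_s`
(`CommDerivations.conj_apply_submax`).

Since the `φ(s)` span `K^n`, there are `n` submaximal vectors, a frame, whose `φ(ρ_a)` form a
basis. The inverse of the matrix of this basis gives the combinations `E_i` that change by `h_i`,
and every other submaximal `s` gives the relation between `φ(s)` and the frame; together these
combinations determine all submaximal coefficients (`DiffOp.Frame.eq_on_submaxVecs`). Their
coefficients are rational in the maximal coefficients, which are fixed on the class, so that they
are values of expressions.

The factorization for a lower vector `v` (`DiffOp.Frame.shape`) has a base parameter for every
direction, a parameter `x_s` for every submaximal `s` outside of the frame, and a parameter `q_w`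
for every lower `w` above `v`. The product for a maximal `m` uses base parameters, except that
direction `i` uses `x_s` if `s = m - e_i` and `i` is the direction chosen for `s`. The product for
`w` uses `q_w` in one direction and base parameters in the others. The coefficients of the
remainder at the frame involve only base parameters, linearly and without derivatives; the one at
`s` involves `x_s` and base parameters; and in the one at `w` the parameter `q_w` occurs linearly,
while `q_u` occurs only if `w ≤ u` (`CommDerivations.factorProd_apply_congr`). So the system for
the parameters is triangular: it is solved uniquely, by expressions in the coefficients
(`DiffOp.Frame.exists_parameters`). By uniqueness, conjugation maps the factorization of `L` to the
one of `w⁻¹ L w`. The remainder has no terms above `v`, so that its coefficient at `v` is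
invariant.

For completeness, let `L` and `L'` have equal invariants. By the compatibility invariants the
differences `h_i` of the values of the `E_i` satisfy `∂_i h_j = ∂_j h_i`. The derivations then
extend to `K(x)` with `∂_i x = h_i`, and also with `∂_i x = h_i x`, so that a differentially closed
`K` contains `g` with `∂_i g = h_i` and `w ≠ 0` with `∂_i w = h_i w`. The operators `w⁻¹ L w` and
`L'` agree at the maximal and the submaximal vectors, and then, from the top down, at the lower
vectors, because an upward invariant is `a_v` minus an expression in coefficients that are already
known to agree (`eq_of_upward`).
-/

noncomputable section

/-! ### Solving first-order systems in a differentially closed field -/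

section Extension

/-- A derivation from an additive map that satisfies the Leibniz rule. -/
def Derivation.ofAddMonoidHom {A : Type*} [CommRing A] (e : A →+ A)
    (he : ∀ a b, e (a * b) = a * e b + b * e a) : Derivation ℤ A A :=
  Derivation.mk' e.toIntLinearMap he

@[simp]
theorem Derivation.ofAddMonoidHom_apply {A : Type*} [CommRing A] (e : A →+ A)
    (he : ∀ a b, e (a * b) = a * e b + b * e a) (a : A) :
    Derivation.ofAddMonoidHom e he a = e a := rfl

/-- A derivation of a domain extends to its field of fractions: `a ↦ a + (d a) ε` is a ring
homomorphism to the dual numbers over the fraction field, and it maps nonzero elements to units. -/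
theorem Derivation.exists_extension_fractionRing {A F : Type*} [CommRing A] [IsDomain A] [Field F]
    [Algebra A F] [IsFractionRing A F] (d : Derivation ℤ A A) :
    ∃ D : Derivation ℤ F F, ∀ a, D (algebraMap A F a) = algebraMap A F (d a) := by
  let φ : A →+* TrivSqZeroExt F F :=
    { toFun := fun a =>
        TrivSqZeroExt.inl (algebraMap A F a) + TrivSqZeroExt.inr (algebraMap A F (d a))
      map_one' := by ext <;> simp
      map_zero' := by ext <;> simp
      map_add' := fun a b => by
        ext
        · simp
        · simp only [map_add, TrivSqZeroExt.snd_add, TrivSqZeroExt.snd_inl, TrivSqZeroExt.snd_inr,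
            zero_add]
      map_mul' := fun a b => by
        ext
        · simp
        · simp only [Derivation.leibniz, smul_eq_mul, map_add, map_mul, TrivSqZeroExt.snd_add,
            TrivSqZeroExt.snd_inl, TrivSqZeroExt.snd_inr, zero_add, TrivSqZeroExt.snd_mul,
            TrivSqZeroExt.fst_add, TrivSqZeroExt.fst_inl, TrivSqZeroExt.fst_inr, add_zero,
            MulOpposite.smul_eq_mul_unop, MulOpposite.unop_op]
          ring }
  have hφ : ∀ y : nonZeroDivisors A, IsUnit (φ y) := by
    intro y
    rw [TrivSqZeroExt.isUnit_iff_isUnit_fst]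
    simp [φ]
  let ψ : F →+* TrivSqZeroExt F F := IsLocalization.lift hφ
  have hψ : ∀ a, ψ (algebraMap A F a) = φ a := fun a => IsLocalization.lift_eq hφ a
  have hfst : ∀ x, (ψ x).fst = x := by
    have h : (TrivSqZeroExt.fstHom F F F : TrivSqZeroExt F F →+* F).comp ψ = RingHom.id F := by
      apply IsLocalization.ringHom_ext (nonZeroDivisors A)
      ext a
      simp [hψ, φ]
    exact fun x => congrArg (fun f : F →+* F => f x) h
  refine ⟨Derivation.ofAddMonoidHom ⟨⟨fun x => (ψ x).snd, by simp⟩, fun x y => by simp⟩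
    fun x y => ?_, fun a => ?_⟩
  · change (ψ (x * y)).snd = x * (ψ y).snd + y * (ψ x).snd
    rw [map_mul, TrivSqZeroExt.snd_mul, hfst, hfst, smul_eq_mul,
      MulOpposite.smul_eq_mul_unop, MulOpposite.unop_op, mul_comm y]
  · simp only [ofAddMonoidHom_apply, AddMonoidHom.coe_mk, ZeroHom.coe_mk, hψ]
    simp only [φ, RingHom.coe_mk, MonoidHom.coe_mk, OneHom.coe_mk, TrivSqZeroExt.snd_add,
      TrivSqZeroExt.snd_inl, TrivSqZeroExt.snd_inr, zero_add]

theorem Derivation.eq_zero_of_algebraMap {A F : Type*} [CommRing A] [IsDomain A] [Field F]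
    [Algebra A F] [IsFractionRing A F] (D : Derivation ℤ F F)
    (h : ∀ a, D (algebraMap A F a) = 0) : D = 0 := by
  ext x
  obtain ⟨a, b, hb, rfl⟩ := IsFractionRing.div_surjective (A := A) x
  simp [Derivation.leibniz_div, h]

/-- Commuting derivations of a domain extend to commuting derivations of its fraction field. -/
theorem CommDerivations.exists_extension_fractionRing {n : ℕ} {A F : Type*} [CommRing A]
    [IsDomain A] [Field F] [Algebra A F] [IsFractionRing A F] (E : CommDerivations n A) :
    ∃ DF : CommDerivations n F, ∀ i a, DF.d i (algebraMap A F a) = algebraMap A F (E.d i a) := by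
  choose G hG using fun i => Derivation.exists_extension_fractionRing (F := F) (E.d i)
  have hGG : ∀ i j, ⁅G i, G j⁆ = 0 := fun i j => by
    apply Derivation.eq_zero_of_algebraMap (A := A)
    intro a
    rw [Derivation.commutator_apply, hG, hG, hG, hG, E.comm i j, sub_self]
  refine ⟨⟨G, fun i j a => ?_⟩, hG⟩
  have := congrArg (fun F : Derivation ℤ _ _ => F a) (hGG i j)
  simpa [Derivation.commutator_apply, sub_eq_zero] using this

/-- The derivation of `A[X]` that extends `d` and maps `X` to `f`. -/
theorem Derivation.exists_extension_polynomial {A : Type*} [CommRing A] (d : Derivation ℤ A A)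
    (f : Polynomial A) : ∃ e : Polynomial A →+ Polynomial A,
      (∀ a b, e (a * b) = a * e b + b * e a) ∧
      (∀ a, e (Polynomial.C a) = Polynomial.C (d a)) ∧ e Polynomial.X = f := by
  let _ : Differential A := ⟨d⟩
  exact ⟨(Differential.implicitDeriv f).toLinearMap.toAddMonoidHom,
    fun a b => (Differential.implicitDeriv f).leibniz a b,
    fun a => Differential.implicitDeriv_C f a, Differential.implicitDeriv_X f⟩

theorem Derivation.commute_of_C_X {A B : Type*} [CommRing A] [CommRing B]
    (ι : Polynomial A ≃+* B) (D D' : Derivation ℤ B B)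
    (hC : ∀ a, D (D' (ι (Polynomial.C a))) = D' (D (ι (Polynomial.C a))))
    (hX : D (D' (ι Polynomial.X)) = D' (D (ι Polynomial.X))) (x : B) : D (D' x) = D' (D x) := by
  rw [← sub_eq_zero, ← Derivation.commutator_apply] at hX ⊢
  have hC' : ∀ a, ⁅D, D'⁆ (ι (Polynomial.C a)) = 0 := fun a => by
    rw [Derivation.commutator_apply, hC, sub_self]
  obtain ⟨p, rfl⟩ := ι.surjective x
  induction p using Polynomial.induction_on' with
  | add p q hp hq => rw [map_add, map_add, hp, hq, add_zero]
  | monomial k a =>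
    rw [← Polynomial.C_mul_X_pow_eq_monomial, map_mul, map_pow, Derivation.leibniz,
      Derivation.leibniz_pow, hC', hX]
    simp

end Extension

namespace CommDerivations

variable {n : ℕ} {K : Type u} [Field K] (D : CommDerivations n K)

/-- Commuting derivations of `K[X]` with prescribed compatible values `∂_i X = f_i`. Compatibility,
`∂_i f_j = ∂_j f_i`, refers to the derivations being constructed, and so it is assumed for all maps
that have their properties apart from commutativity. -/
theorem exists_extension_polynomial (f : Fin n → Polynomial K)
    (hf : ∀ E : Fin n → Polynomial K →+ Polynomial K,
      (∀ i a b, E i (a * b) = a * E i b + b * E i a) →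
      (∀ i a, E i (Polynomial.C a) = Polynomial.C (D.d i a)) → (∀ i, E i Polynomial.X = f i) →
      ∀ i j, E i (f j) = E j (f i)) :
    ∃ E : CommDerivations n (Polynomial K),
      (∀ i a, E.d i (Polynomial.C a) = Polynomial.C (D.d i a)) ∧
      ∀ i, E.d i Polynomial.X = f i := by
  choose e hel heC heX using fun i => Derivation.exists_extension_polynomial (D.d i) (f i)
  exact ⟨⟨fun i => Derivation.ofAddMonoidHom (e i) (hel i), fun i j =>
    Derivation.commute_of_C_X (RingEquiv.refl (Polynomial K)) _ _
      (fun a => by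
        simp only [RingEquiv.refl_apply, Derivation.ofAddMonoidHom_apply, heC, D.comm i j])
      (by simp only [RingEquiv.refl_apply, Derivation.ofAddMonoidHom_apply, heX,
        hf e hel heC heX i j])⟩, heC, heX⟩

/-- A simple transcendental differential extension `K(x)` with prescribed compatible derivatives
`∂_i x = f_i(x)`. -/
theorem exists_extension_field (f : Fin n → Polynomial K)
    (hf : ∀ E : Fin n → Polynomial K →+ Polynomial K,
      (∀ i a b, E i (a * b) = a * E i b + b * E i a) →
      (∀ i a, E i (Polynomial.C a) = Polynomial.C (D.d i a)) → (∀ i, E i Polynomial.X = f i) →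
      ∀ i j, E i (f j) = E j (f i)) :
    ∃ (F : Type u) (_ : Field F) (_ : Algebra K F) (DF : CommDerivations n F) (x : F),
      (∀ i a, DF.d i (algebraMap K F a) = algebraMap K F (D.d i a)) ∧ x ≠ 0 ∧
      ∀ i, DF.d i x = Polynomial.aeval x (f i) := by
  obtain ⟨E, hEC, hEX⟩ := D.exists_extension_polynomial f hf
  obtain ⟨DF, hDF⟩ := exists_extension_fractionRing (F := FractionRing (Polynomial K)) E
  refine ⟨FractionRing (Polynomial K), inferInstance, inferInstance, DF,
    algebraMap (Polynomial K) _ Polynomial.X, fun i a => ?_, ?_, fun i => ?_⟩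
  · have := hDF i (Polynomial.C a)
    rw [hEC] at this
    exact this
  · simp
  · rw [hDF, hEX, Polynomial.aeval_algebraMap_apply, Polynomial.aeval_X_left_apply]

end CommDerivations

/-! ### Iterated application of commuting maps -/

section IterApply

variable {n : ℕ} {A : Type u}

@[simp]
theorem iterApply_zero (f : Fin n → A → A) (a : A) : iterApply f 0 a = a := by
  unfold iterApply
  induction List.finRange n with
  | nil => rfl
  | cons i l ih => simp

theorem foldr_iterate_add_single (f : Fin n → A → A) (hf : ∀ i j a, f i (f j a) = f j (f i a))
    (v : MIdx n) (a : A) (i : Fin n) (l : List (Fin n)) (hl : l.Nodup) :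
    l.foldr (fun j b => (f j)^[(v + MIdx.e i) j] b) a =
      if i ∈ l then f i (l.foldr (fun j b => (f j)^[v j] b) a)
      else l.foldr (fun j b => (f j)^[v j] b) a := by
  induction l with
  | nil => rfl
  | cons j l ih =>
    have hjl : j ∉ l := (List.nodup_cons.mp hl).1
    rw [List.foldr_cons, List.foldr_cons, ih (List.nodup_cons.mp hl).2]
    by_cases hij : i = j
    · subst hij
      simp only [hjl, if_false, List.mem_cons, true_or, if_true]
      simp [← Function.iterate_succ_apply']
    · have hv : (v + MIdx.e i) j = v j := by simp [hij]
      rw [hv]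
      by_cases hil : i ∈ l
      · simp only [hil, if_true, List.mem_cons, or_true]
        exact ((show Function.Commute (f j) (f i) from fun a => hf j i a).iterate_left (v j)) _
      · simp [hil, hij]

theorem iterApply_add_single (f : Fin n → A → A) (hf : ∀ i j a, f i (f j a) = f j (f i a))
    (v : MIdx n) (i : Fin n) (a : A) :
    iterApply f (v + MIdx.e i) a = f i (iterApply f v a) := by
  unfold iterApply
  rw [foldr_iterate_add_single f hf v a i _ (List.nodup_finRange n)]
  simp

end IterApply

namespace CommDerivations

variable {n : ℕ} {K : Type u}

@[simp]
theorem partialD_zero [CommRing K] (D : CommDerivations n K) (a : K) : D.partialD 0 a = a :=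
  iterApply_zero _ _

theorem partialD_add_single [CommRing K] (D : CommDerivations n K) (v : MIdx n) (i : Fin n)
    (a : K) : D.partialD (v + MIdx.e i) a = D.d i (D.partialD v a) :=
  iterApply_add_single _ D.comm v i a

@[simp]
theorem partialD_single [CommRing K] (D : CommDerivations n K) (i : Fin n) (a : K) :
    D.partialD (MIdx.e i) a = D.d i a := by
  rw [← zero_add (MIdx.e i), partialD_add_single, partialD_zero]

variable [Field K] {D : CommDerivations n K}

open MvPolynomial in
/-- In a differentially closed field, a closed form `∑ h_i dx_i` is exact. -/
theorem IsDifferentiallyClosed.exists_potential (hK : D.IsDifferentiallyClosed) (h : Fin n → K)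
    (hh : ∀ i j, D.d i (h j) = D.d j (h i)) : ∃ g, ∀ i, D.d i g = h i := by
  classical
  obtain ⟨F, _, _, DF, x, hDF, -, hx⟩ :=
    D.exists_extension_field (fun i => Polynomial.C (h i)) fun E _ hC _ i j => by
      simp only [hC, hh i j]
  obtain ⟨y, hy, -⟩ := hK 1
    (Finset.univ.image fun i : Fin n => (X (0, MIdx.e i) - C (h i) : MvPolynomial _ K)) 1 F DF hDF
    ⟨fun _ => x, by simp [hx], by simp⟩
  refine ⟨y 0, fun i => ?_⟩
  have := hy _ (Finset.mem_image_of_mem _ (Finset.mem_univ i))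
  simpa [sub_eq_zero] using this

open MvPolynomial in
/-- In a differentially closed field, a closed form `∑ h_i dx_i` is a logarithmic derivative. -/
theorem IsDifferentiallyClosed.exists_exponential (hK : D.IsDifferentiallyClosed) (h : Fin n → K)
    (hh : ∀ i j, D.d i (h j) = D.d j (h i)) : ∃ w, w ≠ 0 ∧ ∀ i, D.d i w = h i * w := by
  classical
  obtain ⟨F, _, _, DF, x, hDF, hx0, hx⟩ :=
    D.exists_extension_field (fun i => Polynomial.C (h i) * Polynomial.X) fun E hE hC hX i j => by
      simp only [hE, hC, hX, hh i j]
      ring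
  obtain ⟨y, hy, hy0⟩ := hK 1
    (Finset.univ.image fun i : Fin n =>
      (X (0, MIdx.e i) - C (h i) * X (0, 0) : MvPolynomial _ K)) (X (0, 0)) F DF hDF
    ⟨fun _ => x, by simp [hx], by simpa using hx0⟩
  refine ⟨y 0, by simpa using hy0, fun i => ?_⟩
  have := hy _ (Finset.mem_image_of_mem _ (Finset.mem_univ i))
  simpa [sub_eq_zero] using this

/-! ### Conjugation of differential operators by a function -/

variable (D)

theorem mulLeftD_add (i : Fin n) (P Q : DiffOp n K) :
    D.mulLeftD i (P + Q) = D.mulLeftD i P + D.mulLeftD i Q := by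
  unfold mulLeftD
  rw [Finsupp.mapRange_add (fun a b => map_add _ a b), Finsupp.mapDomain_add]
  abel

@[simp]
theorem mulLeftD_zero (i : Fin n) : D.mulLeftD i 0 = 0 := by
  simp [mulLeftD]

theorem mulLeftD_smul (i : Fin n) (a : K) (P : DiffOp n K) :
    D.mulLeftD i (a • P) = a • D.mulLeftD i P + D.d i a • P := by
  unfold mulLeftD
  rw [Finsupp.mapDomain_smul]
  ext v
  simp
  ring

theorem mulLeftD_single (i : Fin n) (v : MIdx n) (a : K) :
    D.mulLeftD i (Finsupp.single v a) =
      Finsupp.single v (D.d i a) + Finsupp.single (v + MIdx.e i) a := by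
  simp [mulLeftD, Finsupp.mapDomain_single]

theorem mulLeftD_comm (i j : Fin n) (P : DiffOp n K) :
    D.mulLeftD i (D.mulLeftD j P) = D.mulLeftD j (D.mulLeftD i P) := by
  induction P using Finsupp.induction_linear with
  | zero => simp
  | add P Q hP hQ => simp only [mulLeftD_add, hP, hQ]
  | single v a =>
    simp only [mulLeftD_single, mulLeftD_add, D.comm i j, add_right_comm v]
    abel

theorem mulLeftD_apply_add (i : Fin n) (P : DiffOp n K) (v : MIdx n) :
    D.mulLeftD i P (v + MIdx.e i) = D.d i (P (v + MIdx.e i)) + P v := by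
  simp only [mulLeftD, Finsupp.add_apply, Finsupp.mapRange_apply]
  rw [Finsupp.mapDomain_apply (add_left_injective _)]

theorem mulLeftD_apply_of_eq_zero (i : Fin n) (P : DiffOp n K) (v : MIdx n) (hv : v i = 0) :
    D.mulLeftD i P v = D.d i (P v) := by
  simp only [mulLeftD, Finsupp.add_apply, Finsupp.mapRange_apply]
  rw [Finsupp.mapDomain_of_notMem_range, add_zero]
  rintro ⟨w, rfl⟩
  simp at hv

theorem opMul_add_left (L L' P : DiffOp n K) :
    D.opMul (L + L') P = D.opMul L P + D.opMul L' P :=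
  Finsupp.sum_add_index' (by simp) (by simp [add_smul])

@[simp]
theorem opMul_zero_left (P : DiffOp n K) : D.opMul 0 P = 0 := by simp [opMul]

theorem opMul_single (v : MIdx n) (a : K) (P : DiffOp n K) :
    D.opMul (Finsupp.single v a) P = a • iterApply D.mulLeftD v P := by
  simp [opMul]

theorem opMul_smul_left (a : K) (L P : DiffOp n K) : D.opMul (a • L) P = a • D.opMul L P := by
  induction L using Finsupp.induction_linear with
  | zero => simp
  | add L L' h h' => simp only [smul_add, opMul_add_left, h, h']
  | single v b => rw [Finsupp.smul_single, smul_eq_mul, opMul_single, opMul_single, mul_smul]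

theorem opMul_mulLeftD (i : Fin n) (L P : DiffOp n K) :
    D.opMul (D.mulLeftD i L) P = D.mulLeftD i (D.opMul L P) := by
  induction L using Finsupp.induction_linear with
  | zero => simp
  | add L L' h h' => simp only [mulLeftD_add, opMul_add_left, h, h']
  | single v a =>
    rw [mulLeftD_single, opMul_add_left, opMul_single, opMul_single, opMul_single, mulLeftD_smul,
      iterApply_add_single _ D.mulLeftD_comm, add_comm]

/-- The conjugate `w⁻¹ L w` of `L` by the multiplication operator `w`. -/
def conj (w : K) (L : DiffOp n K) : DiffOp n K :=
  w⁻¹ • D.opMul L (Finsupp.single 0 w)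

theorem conj_add (w : K) (L L' : DiffOp n K) : D.conj w (L + L') = D.conj w L + D.conj w L' := by
  simp [conj, opMul_add_left]

theorem conj_smul (w a : K) (L : DiffOp n K) : D.conj w (a • L) = a • D.conj w L := by
  rw [conj, conj, opMul_smul_left, smul_comm]

/-- Conjugation as a linear map. -/
def conjLinear (w : K) : DiffOp n K →ₗ[K] DiffOp n K where
  toFun := D.conj w
  map_add' := D.conj_add w
  map_smul' := D.conj_smul w

@[simp]
theorem conjLinear_apply (w : K) (L : DiffOp n K) : D.conjLinear w L = D.conj w L := rfl

theorem conj_one {w : K} (hw : w ≠ 0) : D.conj w (Finsupp.single 0 1) = Finsupp.single 0 1 := by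
  rw [conj, opMul_single, iterApply_zero, one_smul, Finsupp.smul_single, smul_eq_mul,
    inv_mul_cancel₀ hw]

/-- `w⁻¹ ∂_i w = ∂_i + h` if `∂_i w = h w`. -/
theorem conj_mulLeftD {w h : K} (hw : w ≠ 0) (i : Fin n) (hh : D.d i w = h * w)
    (L : DiffOp n K) : D.conj w (D.mulLeftD i L) = D.mulLeftD i (D.conj w L) + h • D.conj w L := by
  rw [conj, conj, opMul_mulLeftD, mulLeftD_smul, Derivation.leibniz_inv, hh, add_assoc, smul_smul,
    ← add_smul]
  have : -w⁻¹ ^ 2 • (h * w) + h * w⁻¹ = 0 := by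
    simp only [smul_eq_mul]
    field_simp
    ring
  rw [this, zero_smul, add_zero]

variable {r : ℕ} (dir : Fin r → Fin n) (p : Fin r → K)

@[simp]
theorem factorProd_nil : D.factorProd dir p [] = Finsupp.single 0 1 := rfl

theorem factorProd_cons (k : Fin r) (l : List (Fin r)) :
    D.factorProd dir p (k :: l) =
      D.mulLeftD (dir k) (D.factorProd dir p l) + p k • D.factorProd dir p l := rfl

theorem conj_factorProd {w : K} {h : Fin n → K} (hw : w ≠ 0) (hh : ∀ i, D.d i w = h i * w)
    (l : List (Fin r)) :
    D.conj w (D.factorProd dir p l) = D.factorProd dir (fun k => p k + h (dir k)) l := by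
  induction l with
  | nil => exact D.conj_one hw
  | cons k l ih =>
    rw [factorProd_cons, factorProd_cons, conj_add, conj_smul, conj_mulLeftD D hw _ (hh _), ih,
      add_smul]
    abel

end CommDerivations

/-! ### Coefficients of products of first-order factors -/

/-- The vector `d` in which `d_i` counts the factors of direction `i` in a list of factors. -/
def listDegree {n r : ℕ} (dir : Fin r → Fin n) (l : List (Fin r)) : MIdx n :=
  (l.map fun k => MIdx.e (dir k)).sum

/-- The list of `d_i` copies of `π i` for every direction `i`. -/
def dirList {n r : ℕ} (π : Fin n → Fin r) (d : MIdx n) : List (Fin r) :=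
  (List.finRange n).flatMap fun i => List.replicate (d i) (π i)

section DirList

variable {n r : ℕ} (dir : Fin r → Fin n)

@[simp]
theorem listDegree_nil : listDegree dir [] = 0 := rfl

@[simp]
theorem listDegree_cons (k : Fin r) (l : List (Fin r)) :
    listDegree dir (k :: l) = MIdx.e (dir k) + listDegree dir l := by
  simp [listDegree]

theorem sum_map_dirList {M : Type*} [AddCommMonoid M] (π : Fin n → Fin r) (d : MIdx n)
    (f : Fin r → M) : ((dirList π d).map f).sum = ∑ i, d i • f (π i) := by
  have key : ∀ l : List (Fin n), ((l.flatMap fun i => List.replicate (d i) (π i)).map f).sum =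
      (l.map fun i => d i • f (π i)).sum := fun l => by
    induction l with
    | nil => rfl
    | cons i l ih => simp [ih]
  rw [dirList, key, ← List.sum_ofFn, List.ofFn_eq_map]

theorem mem_dirList {π : Fin n → Fin r} {d : MIdx n} {k : Fin r} (hk : k ∈ dirList π d) :
    ∃ i, d i ≠ 0 ∧ π i = k := by
  obtain ⟨i, -, hi⟩ := List.mem_flatMap.mp hk
  exact ⟨i, (List.mem_replicate.mp hi).1, (List.mem_replicate.mp hi).2.symm⟩

theorem listDegree_dirList {π : Fin n → Fin r} (hπ : ∀ i, dir (π i) = i) (d : MIdx n) :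
    listDegree dir (dirList π d) = d := by
  rw [listDegree, sum_map_dirList]
  simp only [hπ]
  ext i
  simp

@[simp]
theorem listDegree_id_dirList (d : MIdx n) : listDegree id (dirList id d) = d :=
  listDegree_dirList id (fun _ => rfl) d

end DirList

namespace CommDerivations

variable {n : ℕ} {K : Type u} [Field K] (D : CommDerivations n K)
variable {r : ℕ} (dir : Fin r → Fin n)

theorem mulLeftD_apply_of_ne_zero (i : Fin n) (P : DiffOp n K) (v : MIdx n) (hv : v i ≠ 0) :
    D.mulLeftD i P v = D.d i (P v) + P (v - MIdx.e i) := by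
  have h : v - MIdx.e i + MIdx.e i = v := by
    apply tsub_add_cancel_of_le
    rw [Finsupp.single_le_iff]
    omega
  conv_lhs => rw [← h]
  rw [mulLeftD_apply_add, h]

theorem factorProd_apply_of_not_le (p : Fin r → K) (l : List (Fin r)) (u : MIdx n)
    (hu : ¬ u ≤ listDegree dir l) : D.factorProd dir p l u = 0 := by
  induction l generalizing u with
  | nil =>
    rw [factorProd_nil, Finsupp.single_apply, if_neg]
    rintro rfl
    simp at hu
  | cons k l ih =>
    rw [listDegree_cons] at hu
    have h1 : ¬ u ≤ listDegree dir l := fun h => hu (h.trans le_add_self)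
    rw [factorProd_cons, Finsupp.add_apply, Finsupp.smul_apply, ih u h1]
    by_cases hv : u (dir k) = 0
    · rw [mulLeftD_apply_of_eq_zero _ _ _ _ hv, ih u h1]
      simp
    · rw [mulLeftD_apply_of_ne_zero _ _ _ _ hv, ih u h1, ih]
      · simp
      · intro h
        exact hu (tsub_le_iff_left.mp h)

theorem factorProd_apply_listDegree (p : Fin r → K) (l : List (Fin r)) :
    D.factorProd dir p l (listDegree dir l) = 1 := by
  induction l with
  | nil => simp
  | cons k l ih =>
    have h1 : ¬ listDegree dir l + MIdx.e (dir k) ≤ listDegree dir l := by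
      intro h
      have := h (dir k)
      simp at this
    rw [listDegree_cons, factorProd_cons, Finsupp.add_apply, Finsupp.smul_apply,
      add_comm (MIdx.e _), mulLeftD_apply_add, ih, factorProd_apply_of_not_le D dir p l _ h1]
    simp

/-- The coefficient just below the top in direction `i` is the sum of the parameters of
direction `i`. -/
theorem factorProd_apply_of_add_single (p : Fin r → K) (l : List (Fin r)) (u : MIdx n)
    (i : Fin n) (hu : u + MIdx.e i = listDegree dir l) :
    D.factorProd dir p l u = (l.map fun k => if dir k = i then p k else 0).sum := by
  induction l generalizing u with
  | nil =>
    have := DFunLike.congr_fun hu i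
    simp at this
  | cons k l ih =>
    rw [listDegree_cons] at hu
    rw [factorProd_cons, Finsupp.add_apply, Finsupp.smul_apply, List.map_cons, List.sum_cons]
    by_cases hk : dir k = i
    · rw [hk, add_comm] at hu
      have hu' : u = listDegree dir l := add_left_cancel hu
      have h1 : D.factorProd dir p l u = 1 := hu' ▸ factorProd_apply_listDegree D dir p l
      rw [h1, if_pos hk, hk]
      by_cases hv : u i = 0
      · rw [mulLeftD_apply_of_eq_zero _ _ _ _ hv, h1]
        have : (l.map fun k => if dir k = i then p k else 0).sum = 0 := by
          apply List.sum_eq_zero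
          intro x hx
          obtain ⟨m, hm, rfl⟩ := List.mem_map.mp hx
          rw [if_neg]
          rintro hmi
          have h2 : MIdx.e (dir m) ≤ listDegree dir l :=
            List.single_le_sum (by simp) _ (List.mem_map.mpr ⟨m, hm, rfl⟩)
          have h3 := h2 i
          rw [← hu', hv, hmi] at h3
          simp at h3
        rw [this]
        simp
      · rw [mulLeftD_apply_of_ne_zero _ _ _ _ hv, h1, ih]
        · simp [add_comm]
        · rw [← hu']
          apply tsub_add_cancel_of_le
          rw [Finsupp.single_le_iff]
          omega
    · have hv : u (dir k) ≠ 0 := by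
        have := DFunLike.congr_fun hu (dir k)
        simp [Ne.symm hk] at this
        omega
      have h1 : ¬ u ≤ listDegree dir l := by
        intro h
        have h2 := DFunLike.congr_fun hu (dir k)
        have h3 := h (dir k)
        simp [Ne.symm hk] at h2
        omega
      have h2 : MIdx.e (dir k) ≤ u := by
        rw [Finsupp.single_le_iff]
        omega
      rw [mulLeftD_apply_of_ne_zero _ _ _ _ hv, factorProd_apply_of_not_le D dir p l u h1, ih,
        if_neg hk]
      · simp
      · apply add_left_cancel (a := MIdx.e (dir k))
        rw [← hu, ← add_assoc, add_tsub_cancel_of_le h2]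

/-- A parameter of direction `i` enters only the coefficients in which at least one factor `∂_i`
is missing. -/
theorem factorProd_apply_congr {p p' : Fin r → K} {l : List (Fin r)} {u : MIdx n} (i : Fin n)
    (hp : ∀ k ∈ l, dir k ≠ i → p k = p' k) (hu : listDegree dir l i ≤ u i) :
    D.factorProd dir p l u = D.factorProd dir p' l u := by
  induction l generalizing u with
  | nil => rfl
  | cons k l ih =>
    have hp' : ∀ k ∈ l, dir k ≠ i → p k = p' k := fun k hk => hp k (List.mem_cons_of_mem _ hk)
    rw [listDegree_cons, Finsupp.add_apply] at hu
    have ih1 := ih hp' (u := u) (by omega)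
    rw [factorProd_cons, factorProd_cons, Finsupp.add_apply, Finsupp.add_apply, Finsupp.smul_apply,
      Finsupp.smul_apply, ← ih1]
    congr 1
    · by_cases hv : u (dir k) = 0
      · rw [mulLeftD_apply_of_eq_zero _ _ _ _ hv, mulLeftD_apply_of_eq_zero _ _ _ _ hv, ih1]
      · rw [mulLeftD_apply_of_ne_zero _ _ _ _ hv, mulLeftD_apply_of_ne_zero _ _ _ _ hv, ih1,
          ih hp' (u := u - MIdx.e (dir k))]
        rw [Finsupp.tsub_apply]
        omega
    · by_cases hk : dir k = i
      · have h1 : ¬ u ≤ listDegree dir l := by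
          intro h
          have h3 := h i
          simp [hk] at hu
          omega
        rw [factorProd_apply_of_not_le D dir p l u h1]
        simp
      · rw [hp k List.mem_cons_self hk]

theorem factorProd_congr {p p' : Fin r → K} {l : List (Fin r)} (hp : ∀ k ∈ l, p k = p' k) :
    D.factorProd dir p l = D.factorProd dir p' l := by
  induction l with
  | nil => rfl
  | cons k l ih =>
    rw [factorProd_cons, factorProd_cons, ih fun k hk => hp k (List.mem_cons_of_mem _ hk),
      hp k List.mem_cons_self]

theorem factorProd_dirList_apply {π : Fin n → Fin r} (hπ : ∀ i, dir (π i) = i) (p : Fin r → K)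
    (u d : MIdx n) (i : Fin n) (hu : u + MIdx.e i = d) :
    D.factorProd dir p (dirList π d) u = ((u i : K) + 1) * p (π i) := by
  rw [factorProd_apply_of_add_single D dir p _ u i (by rw [hu, listDegree_dirList dir hπ]),
    sum_map_dirList]
  simp [hπ, ← hu]

theorem factorProd_zero (l : List (Fin r)) :
    D.factorProd dir 0 l = Finsupp.single (listDegree dir l) 1 := by
  induction l with
  | nil => rfl
  | cons k l ih =>
    rw [factorProd_cons, ih, mulLeftD_single, listDegree_cons]
    simp [add_comm]

/-- The conjugate of `∂^u` is `∏_i (∂_i + h_i)^{u_i}`. -/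
theorem conj_single {w : K} {h : Fin n → K} (hw : w ≠ 0) (hh : ∀ i, D.d i w = h i * w)
    (u : MIdx n) : D.conj w (Finsupp.single u 1) = D.factorProd id h (dirList id u) := by
  have h1 := conj_factorProd D id 0 hw hh (dirList id u)
  rw [factorProd_zero, listDegree_id_dirList] at h1
  simpa using h1

theorem conj_apply {w : K} {h : Fin n → K} (hw : w ≠ 0) (hh : ∀ i, D.d i w = h i * w)
    (L : DiffOp n K) (v : MIdx n) :
    D.conj w L v = ∑ u ∈ L.support, L u * D.factorProd id h (dirList id u) v := by
  have h1 : L = ∑ u ∈ L.support, L u • Finsupp.single u 1 := by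
    conv_lhs => rw [← Finsupp.sum_single L]
    simp [Finsupp.sum]
  conv_lhs => rw [h1]
  rw [← conjLinear_apply, map_sum, Finsupp.finsetSum_apply]
  refine Finset.sum_congr rfl fun u _ => ?_
  rw [map_smul, conjLinear_apply, conj_single D hw hh, Finsupp.smul_apply, smul_eq_mul]

/-- If `L` has no terms above `v`, then the coefficient at `v` is not changed by conjugation. -/
theorem conj_apply_of_forall_not_lt {w : K} {h : Fin n → K} (hw : w ≠ 0)
    (hh : ∀ i, D.d i w = h i * w) (L : DiffOp n K) (v : MIdx n) (hv : ∀ u, v < u → L u = 0) :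
    D.conj w L v = L v := by
  rw [conj_apply D hw hh, Finset.sum_eq_single v]
  · have := factorProd_apply_listDegree D id h (dirList id v)
    rw [listDegree_id_dirList] at this
    rw [this, mul_one]
  · intro u _ huv
    by_cases hle : v ≤ u
    · rw [hv u (lt_of_le_of_ne hle (Ne.symm huv)), zero_mul]
    · rw [factorProd_apply_of_not_le, mul_zero]
      rwa [listDegree_id_dirList]
  · intro hv
    rw [Finsupp.notMem_support_iff.mp hv, zero_mul]

theorem exists_le_of_conj_apply_ne_zero {w : K} {h : Fin n → K} (hw : w ≠ 0)
    (hh : ∀ i, D.d i w = h i * w) (L : DiffOp n K) (v : MIdx n) (hv : D.conj w L v ≠ 0) :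
    ∃ u, L u ≠ 0 ∧ v ≤ u := by
  rw [conj_apply D hw hh] at hv
  obtain ⟨u, hu, hne⟩ := Finset.exists_ne_zero_of_sum_ne_zero hv
  refine ⟨u, Finsupp.mem_support_iff.mp hu, ?_⟩
  by_contra hle
  apply hne
  rw [factorProd_apply_of_not_le, mul_zero]
  rwa [listDegree_id_dirList]

end CommDerivations

/-! ### Maximal, submaximal and lower vectors -/

namespace MIdx

variable {n : ℕ}

theorem exists_add_e_le {v w : MIdx n} (h : v < w) : ∃ i, v + MIdx.e i ≤ w := by
  obtain ⟨hle, i, hi⟩ := Finsupp.lt_def.mp h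
  refine ⟨i, fun j => ?_⟩
  have := hle j
  by_cases hij : i = j
  · subst hij
    simpa using hi
  · simpa [hij] using this

theorem lt_add_e (v : MIdx n) (i : Fin n) : v < v + MIdx.e i :=
  lt_add_of_pos_right v (pos_iff_ne_zero.mpr (by simp))

theorem covBy_iff {v w : MIdx n} : v ⋖ w ↔ ∃ i, w = v + MIdx.e i := by
  constructor
  · intro h
    obtain ⟨i, hi⟩ := exists_add_e_le h.lt
    refine ⟨i, ?_⟩
    rcases hi.eq_or_lt with h1 | h1
    · exact h1.symm
    · exact absurd h1 (h.2 (lt_add_e v i))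
  · rintro ⟨i, rfl⟩
    refine ⟨lt_add_e v i, fun c hc hc' => ?_⟩
    obtain ⟨j, hj⟩ := exists_add_e_le hc
    have h1 : MIdx.e j < MIdx.e i := (add_lt_add_iff_left v).mp (hj.trans_lt hc')
    have h2 := h1.le j
    by_cases hij : i = j
    · exact h1.ne (by rw [hij])
    · simp [hij] at h2

/-- A sum over vectors that is concentrated on the covers of `s`. -/
theorem sum_eq_sum_covers {M : Type*} [AddCommMonoid M] (s : MIdx n) (A : Finset (MIdx n))
    (f : MIdx n → M) (hf : ∀ u ∈ A, (∀ i, u ≠ s + MIdx.e i) → f u = 0)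
    (hA : ∀ i, s + MIdx.e i ∉ A → f (s + MIdx.e i) = 0) :
    ∑ u ∈ A, f u = ∑ i, f (s + MIdx.e i) := by
  classical
  have hinj : Function.Injective fun i : Fin n => s + MIdx.e i := fun i j hij =>
    (Finsupp.single_left_injective one_ne_zero) (add_left_cancel hij)
  rw [← Finset.sum_image (s := Finset.univ) (g := fun i => s + MIdx.e i) hinj.injOn]
  have h1 : ∑ u ∈ A, f u = ∑ u ∈ A ∪ Finset.univ.image fun i => s + MIdx.e i, f u := by
    refine Finset.sum_subset Finset.subset_union_left fun u hu huA => ?_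
    obtain ⟨i, -, rfl⟩ := Finset.mem_image.mp ((Finset.mem_union.mp hu).resolve_left huA)
    exact hA i huA
  rw [h1]
  symm
  refine Finset.sum_subset Finset.subset_union_right fun u hu hui => ?_
  refine hf u ((Finset.mem_union.mp hu).resolve_right hui) fun i hi => hui ?_
  exact Finset.mem_image.mpr ⟨i, Finset.mem_univ i, hi.symm⟩

end MIdx

namespace DiffOp

variable {n : ℕ} {K : Type u} [Field K] {T : DiffOp n K}

theorem mem_downVecs {v : MIdx n} : v ∈ downVecs T ↔ ∃ m ∈ T.support, v ≤ m := by
  simp [downVecs]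

theorem downVecs_of_le {v w : MIdx n} (hw : w ∈ downVecs T) (h : v ≤ w) : v ∈ downVecs T := by
  obtain ⟨m, hm, hwm⟩ := mem_downVecs.mp hw
  exact mem_downVecs.mpr ⟨m, hm, h.trans hwm⟩

theorem support_subset_downVecs : T.support ⊆ downVecs T := fun m hm =>
  mem_downVecs.mpr ⟨m, hm, le_rfl⟩

theorem mem_submaxVecs {v : MIdx n} : v ∈ submaxVecs T ↔
    v ∈ downVecs T ∧ (∃ m ∈ T.support, v ⋖ m) ∧ ∀ w ∈ downVecs T, v ⋖ w → w ∈ T.support := by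
  simp [submaxVecs]

theorem mem_lowVecs {v : MIdx n} : v ∈ lowVecs T ↔
    v ∈ downVecs T ∧ v ∉ T.support ∧ v ∉ submaxVecs T := by
  simp [lowVecs]

theorem eq_of_mem_support_of_le (hT : IsTermAntichain T) {m u : MIdx n} (hm : m ∈ T.support)
    (hu : u ∈ downVecs T) (h : m ≤ u) : u = m := by
  obtain ⟨m', hm', hle⟩ := mem_downVecs.mp hu
  have := hT.eq hm hm' (h.trans hle)
  exact le_antisymm (this ▸ hle) h

theorem submaxVecs_notMem_support (hT : IsTermAntichain T) {s : MIdx n} (hs : s ∈ submaxVecs T) :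
    s ∉ T.support := fun h => by
  obtain ⟨-, ⟨m, hm, hsm⟩, -⟩ := mem_submaxVecs.mp hs
  exact hsm.lt.ne' (eq_of_mem_support_of_le hT h (support_subset_downVecs hm) hsm.le)

theorem exists_of_submaxVecs_lt (hT : IsTermAntichain T) {s u : MIdx n} (hs : s ∈ submaxVecs T)
    (hu : u ∈ downVecs T) (h : s < u) : ∃ i, u = s + MIdx.e i ∧ s + MIdx.e i ∈ T.support := by
  obtain ⟨i, hi⟩ := MIdx.exists_add_e_le h
  have h1 := (mem_submaxVecs.mp hs).2.2 _ (downVecs_of_le hu hi) (MIdx.covBy_iff.mpr ⟨i, rfl⟩)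
  exact ⟨i, eq_of_mem_support_of_le hT h1 hu hi, h1⟩

theorem exists_of_mem_submaxVecs {s : MIdx n} (hs : s ∈ submaxVecs T) :
    ∃ i, s + MIdx.e i ∈ T.support := by
  obtain ⟨-, ⟨m, hm, hsm⟩, -⟩ := mem_submaxVecs.mp hs
  obtain ⟨i, rfl⟩ := MIdx.covBy_iff.mp hsm
  exact ⟨i, hm⟩

/-- A lower vector is covered by a vector of the down set that is not maximal. -/
theorem exists_of_mem_lowVecs {w : MIdx n} (hw : w ∈ lowVecs T) :
    ∃ i, w + MIdx.e i ∈ downVecs T ∧ w + MIdx.e i ∉ T.support := by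
  obtain ⟨hd, hM, hS⟩ := mem_lowVecs.mp hw
  by_contra! hcon
  obtain ⟨m, hm, hwm⟩ := mem_downVecs.mp hd
  obtain ⟨i, hi⟩ := MIdx.exists_add_e_le (lt_of_le_of_ne hwm fun h => hM (h ▸ hm))
  refine hS (mem_submaxVecs.mpr ⟨hd, ⟨w + MIdx.e i, ?_, MIdx.covBy_iff.mpr ⟨i, rfl⟩⟩, ?_⟩)
  · exact hcon i (mem_downVecs.mpr ⟨m, hm, hi⟩)
  · intro u hu hwu
    obtain ⟨j, rfl⟩ := MIdx.covBy_iff.mp hwu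
    exact hcon j hu

theorem lowVecs_of_le (hT : IsTermAntichain T) {v w : MIdx n} (hw : w ∈ lowVecs T) (h : v ≤ w) :
    v ∈ lowVecs T := by
  obtain ⟨hd, hM, hS⟩ := mem_lowVecs.mp hw
  refine mem_lowVecs.mpr ⟨downVecs_of_le hd h, fun hv => ?_, fun hv => ?_⟩
  · exact hM (eq_of_mem_support_of_le hT hv hd h ▸ hv)
  · rcases h.eq_or_lt with rfl | hlt
    · exact hS hv
    · obtain ⟨i, rfl, hi⟩ := exists_of_submaxVecs_lt hT hv hd hlt
      exact hM hi

theorem mem_maxGen_iff (hT : IsTermAntichain T) {L : DiffOp n K} : L ∈ MaxGen T ↔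
    (∀ m ∈ T.support, L m = T m) ∧ ∀ v, L v ≠ 0 → v ∈ downVecs T := by
  classical
  constructor
  · rintro (h : lead L = T)
    have hmax : ∀ m, m ∈ T.support ↔ L m ≠ 0 ∧ Maximal (fun w => w ∈ L.support) m := fun m => by
      rw [← h, lead, Finsupp.support_filter, Finset.mem_filter, Finsupp.mem_support_iff]
    refine ⟨fun m hm => ?_, fun v hv => ?_⟩
    · conv_rhs => rw [← h, lead]
      rw [Finsupp.filter_apply_pos _ _ ((hmax m).mp hm).2]
    · obtain ⟨m, hvm, hm⟩ := L.support.exists_le_maximal (Finsupp.mem_support_iff.mpr hv)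
      exact mem_downVecs.mpr
        ⟨m, (hmax m).mpr ⟨Finsupp.mem_support_iff.mp hm.prop, hm⟩, hvm⟩
  · rintro ⟨h1, h2⟩
    have hsup : ∀ m ∈ T.support, m ∈ L.support := fun m hm => by
      rw [Finsupp.mem_support_iff, h1 m hm]
      exact Finsupp.mem_support_iff.mp hm
    change lead L = T
    ext v
    rw [lead, Finsupp.filter_apply]
    split_ifs with hv
    · obtain ⟨m, hm, hvm⟩ := mem_downVecs.mp (h2 v (Finsupp.mem_support_iff.mp hv.prop))
      rw [hv.eq_of_le (hsup m hm) hvm, h1 m hm]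
    · symm
      by_contra hne
      have hvT := Finsupp.mem_support_iff.mpr hne
      exact hv ⟨hsup v hvT, fun u hu hvu =>
        (eq_of_mem_support_of_le hT hvT (h2 u (Finsupp.mem_support_iff.mp hu)) hvu).le⟩

theorem phi_apply_ne_zero [CharZero K] {s : MIdx n} {i : Fin n} (h : s + MIdx.e i ∈ T.support) :
    phi T s i ≠ 0 :=
  mul_ne_zero (Nat.cast_add_one_ne_zero _) (Finsupp.mem_support_iff.mp h)

end DiffOp

namespace CommDerivations

open DiffOp

variable {n : ℕ} {K : Type u} [Field K] (D : CommDerivations n K) {T : DiffOp n K}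

theorem conj_mem_maxGen (hT : IsTermAntichain T) {w : K} {h : Fin n → K} (hw : w ≠ 0)
    (hh : ∀ i, D.d i w = h i * w) {L : DiffOp n K} (hL : L ∈ MaxGen T) :
    D.conj w L ∈ MaxGen T := by
  rw [mem_maxGen_iff hT] at hL ⊢
  refine ⟨fun m hm => ?_, fun v hv => ?_⟩
  · rw [conj_apply_of_forall_not_lt D hw hh, hL.1 m hm]
    intro u hu
    by_contra hne
    exact hu.ne' (eq_of_mem_support_of_le hT hm (hL.2 u hne) hu.le)
  · obtain ⟨u, hu, hvu⟩ := exists_le_of_conj_apply_ne_zero D hw hh L v hv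
    exact downVecs_of_le (hL.2 u hu) hvu

/-- Under conjugation, the submaximal coefficient `a_s` changes by `φ(s) · h`. -/
theorem conj_apply_submax (hT : IsTermAntichain T) {w : K} {h : Fin n → K} (hw : w ≠ 0)
    (hh : ∀ i, D.d i w = h i * w) {L : DiffOp n K} (hL : L ∈ MaxGen T) {s : MIdx n}
    (hs : s ∈ submaxVecs T) : D.conj w L s = L s + phi T s ⬝ᵥ h := by
  classical
  rw [mem_maxGen_iff hT] at hL
  have hLT : ∀ i, L (s + MIdx.e i) = T (s + MIdx.e i) := fun i => by
    by_cases hi : s + MIdx.e i ∈ T.support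
    · exact hL.1 _ hi
    · rw [Finsupp.notMem_support_iff.mp hi]
      by_contra hne
      exact hi ((mem_submaxVecs.mp hs).2.2 _ (hL.2 _ hne) (MIdx.covBy_iff.mpr ⟨i, rfl⟩))
  rw [conj_apply D hw hh]
  have h1 : ∑ u ∈ L.support, L u * D.factorProd id h (dirList id u) s =
      ∑ u ∈ insert s L.support, L u * D.factorProd id h (dirList id u) s := by
    refine Finset.sum_subset (Finset.subset_insert _ _) fun u _ hu => ?_
    rw [Finsupp.notMem_support_iff.mp hu, zero_mul]
  have h2 := factorProd_apply_listDegree D id h (dirList id s)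
  rw [listDegree_id_dirList] at h2
  rw [h1, ← Finset.add_sum_erase _ _ (Finset.mem_insert_self s _), h2, mul_one,
    MIdx.sum_eq_sum_covers s]
  · congr 1
    refine Finset.sum_congr rfl fun i _ => ?_
    rw [factorProd_dirList_apply D id (π := id) (fun _ => rfl) h s _ i rfl, hLT, phi, id]
    ring
  · intro u hu hne
    have hu' := Finset.mem_erase.mp hu
    have hu2 : L u ≠ 0 := Finsupp.mem_support_iff.mp
      ((Finset.mem_insert.mp hu'.2).resolve_left hu'.1)
    rw [factorProd_apply_of_not_le, mul_zero]
    rw [listDegree_id_dirList]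
    intro hle
    obtain ⟨i, hi, -⟩ := exists_of_submaxVecs_lt hT hs (hL.2 u hu2)
      (lt_of_le_of_ne hle (Ne.symm hu'.1))
    exact hne i hi
  · intro i hi
    have : L (s + MIdx.e i) = 0 := by
      by_contra hne
      exact hi (Finset.mem_erase.mpr ⟨(MIdx.lt_add_e s i).ne',
        Finset.mem_insert_of_mem (Finsupp.mem_support_iff.mpr hne)⟩)
    rw [this, zero_mul]

end CommDerivations

/-! ### The ring of differential rational expressions -/

namespace CoeffExpr

variable {n : ℕ} {K : Type u} [Field K] [CharZero K] (D : CommDerivations n K)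

open MvPolynomial

/-- The derivation `∂_i` of the ring of differential polynomials: `∂^w a_v ↦ ∂^{w + e_i} a_v`. -/
def polyDeriv (i : Fin n) : Derivation ℚ (MvPolynomial (MIdx n × MIdx n) ℚ)
    (MvPolynomial (MIdx n × MIdx n) ℚ) :=
  mkDerivation ℚ fun x => X (x.1, x.2 + MIdx.e i)

theorem polyDeriv_mem_supported (i : Fin n) {A : Set (MIdx n)}
    {p : MvPolynomial (MIdx n × MIdx n) ℚ} (hp : p ∈ supported ℚ {x | x.1 ∈ A}) :
    polyDeriv i p ∈ supported ℚ {x : MIdx n × MIdx n | x.1 ∈ A} := by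
  rw [supported] at hp
  induction hp using Algebra.adjoin_induction with
  | mem p hp =>
    obtain ⟨x, hx, rfl⟩ := hp
    rw [polyDeriv, mkDerivation_X, X_mem_supported]
    exact hx
  | algebraMap c => simp
  | add p q _ _ hp hq =>
    rw [map_add]
    exact add_mem hp hq
  | mul p q hp' hq' hp hq =>
    rw [Derivation.leibniz]
    exact add_mem (mul_mem hp' hq) (mul_mem hq' hp)

theorem d_algebraMap_rat (i : Fin n) (c : ℚ) : D.d i (algebraMap ℚ K c) = 0 := by
  rw [eq_ratCast, ← Rat.num_div_den c]
  push_cast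
  rw [Derivation.leibniz_div]
  simp

theorem polyValue_polyDeriv (i : Fin n) (p : MvPolynomial (MIdx n × MIdx n) ℚ) (L : DiffOp n K) :
    polyValue D (polyDeriv i p) L = D.d i (polyValue D p L) := by
  unfold polyValue
  induction p using MvPolynomial.induction_on with
  | C c =>
    rw [aeval_C, d_algebraMap_rat, ← algebraMap_eq, Derivation.map_algebraMap, map_zero]
  | add p q hp hq => simp only [map_add, hp, hq]
  | mul_X p x hp =>
    rw [Derivation.leibniz, map_add, smul_eq_mul, smul_eq_mul, map_mul, map_mul, hp, map_mul,
      Derivation.leibniz, polyDeriv, mkDerivation_X]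
    simp only [aeval_X, D.partialD_add_single, smul_eq_mul]

variable (𝓛 : Set (DiffOp n K)) (A : Set (MIdx n))

/-- `f` is given on the class `𝓛` by an expression that is defined there and involves only
coefficients `a_w` with `w ∈ A`. -/
def Represents (I : CoeffExpr n) (f : DiffOp n K → K) : Prop :=
  I.InvolvesOnly A ∧ I.IsDefinedOn D 𝓛 ∧ ∀ L ∈ 𝓛, I.value D L = f L

theorem involvesOnly_iff {I : CoeffExpr n} {A : Set (MIdx n)} : I.InvolvesOnly A ↔
    I.num ∈ supported ℚ {x | x.1 ∈ A} ∧ I.den ∈ supported ℚ {x | x.1 ∈ A} := by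
  rw [mem_supported, mem_supported]
  exact ⟨fun h => ⟨fun x hx => h x (Or.inl hx), fun x hx => h x (Or.inr hx)⟩,
    fun h x hx => hx.elim (fun hx => h.1 hx) (fun hx => h.2 hx)⟩

/-- The functions on operators that are given on the class `𝓛` by an expression which is defined
there and involves only coefficients `a_w` with `w ∈ A`. -/
def exprRing : Subring (DiffOp n K → K) where
  carrier := {f | ∃ I, Represents D 𝓛 A I f}
  zero_mem' := ⟨⟨0, 1⟩, involvesOnly_iff.mpr ⟨zero_mem _, one_mem _⟩,
    fun L _ => by simp [polyValue], fun L _ => by simp [value, polyValue]⟩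
  one_mem' := ⟨⟨1, 1⟩, involvesOnly_iff.mpr ⟨one_mem _, one_mem _⟩,
    fun L _ => by simp [polyValue], fun L _ => by simp [value, polyValue]⟩
  neg_mem' := by
    rintro f ⟨I, hI, hd, hv⟩
    rw [involvesOnly_iff] at hI
    refine ⟨⟨-I.num, I.den⟩, involvesOnly_iff.mpr ⟨neg_mem hI.1, hI.2⟩, hd, fun L hL => ?_⟩
    have := hv L hL
    simp only [value, polyValue, map_neg, neg_div, Pi.neg_apply] at this ⊢
    rw [this]
  add_mem' := by
    rintro f g ⟨I, hI, hd, hv⟩ ⟨J, hJ, hd', hv'⟩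
    rw [involvesOnly_iff] at hI hJ
    refine ⟨⟨I.num * J.den + I.den * J.num, I.den * J.den⟩, involvesOnly_iff.mpr
      ⟨add_mem (mul_mem hI.1 hJ.2) (mul_mem hI.2 hJ.1), mul_mem hI.2 hJ.2⟩,
      fun L hL => ?_, fun L hL => ?_⟩
    · simp only [polyValue, map_mul]
      exact mul_ne_zero (hd L hL) (hd' L hL)
    · have h1 := hd L hL
      have h2 := hd' L hL
      rw [Pi.add_apply, ← hv L hL, ← hv' L hL]
      simp only [value, polyValue, map_mul, map_add] at h1 h2 ⊢
      rw [div_add_div _ _ h1 h2]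
  mul_mem' := by
    rintro f g ⟨I, hI, hd, hv⟩ ⟨J, hJ, hd', hv'⟩
    rw [involvesOnly_iff] at hI hJ
    refine ⟨⟨I.num * J.num, I.den * J.den⟩, involvesOnly_iff.mpr
      ⟨mul_mem hI.1 hJ.1, mul_mem hI.2 hJ.2⟩, fun L hL => ?_, fun L hL => ?_⟩
    · simp only [polyValue, map_mul]
      exact mul_ne_zero (hd L hL) (hd' L hL)
    · rw [Pi.mul_apply, ← hv L hL, ← hv' L hL]
      simp only [value, polyValue, map_mul]
      rw [div_mul_div_comm]

variable {D 𝓛 A}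

theorem mem_exprRing {f : DiffOp n K → K} :
    f ∈ exprRing D 𝓛 A ↔ ∃ I, Represents D 𝓛 A I f := Iff.rfl

theorem coeff_mem_exprRing {v : MIdx n} (hv : v ∈ A) : (fun L => L v) ∈ exprRing D 𝓛 A :=
  ⟨coeff v, involvesOnly_iff.mpr ⟨X_mem_supported.mpr hv, one_mem _⟩,
    fun L _ => by simp [polyValue, coeff], fun L _ => by simp [value, polyValue, coeff]⟩

theorem d_mem_exprRing {f : DiffOp n K → K} (hf : f ∈ exprRing D 𝓛 A) (i : Fin n) :
    (fun L => D.d i (f L)) ∈ exprRing D 𝓛 A := by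
  obtain ⟨I, hI, hd, hv⟩ := hf
  rw [involvesOnly_iff] at hI
  refine ⟨⟨I.den * polyDeriv i I.num - I.num * polyDeriv i I.den, I.den ^ 2⟩,
    involvesOnly_iff.mpr ⟨sub_mem (mul_mem hI.2 (polyDeriv_mem_supported i hI.1))
      (mul_mem hI.1 (polyDeriv_mem_supported i hI.2)), pow_mem hI.2 2⟩,
    fun L hL => ?_, fun L hL => ?_⟩
  · simp only [polyValue, map_pow]
    exact pow_ne_zero 2 (hd L hL)
  · change _ = D.d i (f L)
    rw [← hv L hL, value, value, Derivation.leibniz_div, ← polyValue_polyDeriv,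
      ← polyValue_polyDeriv]
    simp only [polyValue, map_sub, map_mul, map_pow, smul_eq_mul]
    ring

theorem inv_mem_exprRing {f : DiffOp n K → K} (hf : f ∈ exprRing D 𝓛 A)
    (h0 : ∀ L ∈ 𝓛, f L ≠ 0) : (fun L => (f L)⁻¹) ∈ exprRing D 𝓛 A := by
  obtain ⟨I, hI, hd, hv⟩ := hf
  rw [involvesOnly_iff] at hI
  refine ⟨⟨I.den, I.num⟩, involvesOnly_iff.mpr ⟨hI.2, hI.1⟩, fun L hL h => ?_, fun L hL => ?_⟩
  · apply h0 L hL
    rw [← hv L hL, value]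
    change polyValue D I.num L = 0 at h
    rw [h, zero_div]
  · change _ = (f L)⁻¹
    rw [← hv L hL, value, value, inv_div]

theorem congr_mem_exprRing {f g : DiffOp n K → K} (hf : f ∈ exprRing D 𝓛 A)
    (h : ∀ L ∈ 𝓛, f L = g L) : g ∈ exprRing D 𝓛 A := by
  obtain ⟨I, hI, hd, hv⟩ := hf
  exact ⟨I, hI, hd, fun L hL => (hv L hL).trans (h L hL)⟩

open DiffOp in
/-- On a maximally generated class the maximal coefficients are fixed, so that every constant in
the field generated by them is the value of an expression. -/
theorem const_mem_exprRing {T : DiffOp n K} (hT : IsTermAntichain T)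
    (hA : ∀ m ∈ T.support, m ∈ A) {c : K} (hc : c ∈ Subfield.closure (Set.range T)) :
    (fun _ => c) ∈ exprRing D (MaxGen T) A := by
  induction hc using Subfield.closure_induction with
  | mem x hx =>
    obtain ⟨m, rfl⟩ := hx
    by_cases hm : m ∈ T.support
    · exact congr_mem_exprRing (coeff_mem_exprRing (hA m hm)) fun L hL =>
        ((mem_maxGen_iff hT).mp hL).1 m hm
    · rw [Finsupp.notMem_support_iff.mp hm]
      exact zero_mem _
  | one => exact one_mem _
  | add x y _ _ hx hy => exact add_mem hx hy
  | neg x _ hx => exact neg_mem hx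
  | inv x _ hx =>
    by_cases h0 : x = 0
    · rw [h0, inv_zero]
      exact zero_mem _
    · exact inv_mem_exprRing hx fun _ _ => h0
  | mul x y _ _ hx hy => exact mul_mem hx hy

open CommDerivations in
theorem factorProd_mem_exprRing {r : ℕ} (dir : Fin r → Fin n) {p : Fin r → DiffOp n K → K}
    {l : List (Fin r)} (hp : ∀ k ∈ l, p k ∈ exprRing D 𝓛 A) (u : MIdx n) :
    (fun L => D.factorProd dir (fun k => p k L) l u) ∈ exprRing D 𝓛 A := by
  induction l generalizing u with
  | nil =>
    simp only [factorProd_nil, Finsupp.single_apply]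
    split_ifs
    · exact one_mem _
    · exact zero_mem _
  | cons k l ih =>
    have ih' := ih fun k hk => hp k (List.mem_cons_of_mem _ hk)
    have hk := hp k List.mem_cons_self
    simp only [factorProd_cons, Finsupp.add_apply, Finsupp.smul_apply, smul_eq_mul]
    refine add_mem ?_ (mul_mem hk (ih' u))
    by_cases hv : u (dir k) = 0
    · simp only [mulLeftD_apply_of_eq_zero _ _ _ _ hv]
      exact d_mem_exprRing (ih' u) _
    · simp only [mulLeftD_apply_of_ne_zero _ _ _ _ hv]
      exact add_mem (d_mem_exprRing (ih' u) _) (ih' _)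

end CoeffExpr

/-! ### Frames of submaximal vectors -/

/-- The entries of the inverse of a matrix over a subfield lie in the subfield. -/
theorem Matrix.inv_apply_mem_subfield {m : Type*} [Fintype m] [DecidableEq m] {K : Type*} [Field K]
    (F : Subfield K) (A : Matrix m m K) (hA : ∀ i j, A i j ∈ F) (i j : m) : A⁻¹ i j ∈ F := by
  let B : Matrix m m F := Matrix.of fun i j => ⟨A i j, hA i j⟩
  have hB : A = F.subtype.mapMatrix B := by
    ext
    rfl
  rw [Matrix.inv_def, hB, ← RingHom.map_det, ← RingHom.map_adjugate, Ring.inverse_eq_inv',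
    ← map_inv₀]
  exact (B.det⁻¹ * B.adjugate i j).2

namespace DiffOp

variable {n : ℕ} {K : Type u} [Field K] {T : DiffOp n K}

theorem phi_mem_closure (s : MIdx n) (i : Fin n) :
    phi T s i ∈ Subfield.closure (Set.range T) :=
  mul_mem (add_mem (natCast_mem _ _) (one_mem _)) (Subfield.subset_closure ⟨_, rfl⟩)

/-- A choice of `n` submaximal vectors `ρ_a` whose vectors `φ(ρ_a)` form a basis of `K^n`, with the
inverse `c` of the matrix of the `φ(ρ_a)`. The entries of `c` are rational in the coefficients of
`T`, so that they are values of expressions. -/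
structure Frame (T : DiffOp n K) where
  ρ : Fin n → MIdx n
  c : Matrix (Fin n) (Fin n) K
  injective : Function.Injective ρ
  mem : ∀ a, ρ a ∈ submaxVecs T
  c_mem : ∀ i a, c i a ∈ Subfield.closure (Set.range T)
  c_mul : c * (Matrix.of fun a i => phi T (ρ a) i) = 1
  mul_c : (Matrix.of fun a i => phi T (ρ a) i) * c = 1

theorem IsFramed.nonempty_frame (h : IsFramed T) : Nonempty (Frame T) := by
  obtain ⟨b, hbs, hspan, hli⟩ := exists_linearIndependent K (phi T '' (submaxVecs T : Set (MIdx n)))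
  rw [h] at hspan
  let B : Module.Basis b K (Fin n → K) := Module.Basis.mk hli (by simp [hspan])
  have hb : b.Finite := (Finset.finite_toSet _).image _ |>.subset hbs
  have := hb.fintype
  have hcard : Fintype.card b = n := by
    rw [← Module.finrank_eq_card_basis B, Module.finrank_fin_fun]
  let e : Fin n ≃ b := (Fintype.equivFinOfCardEq hcard).symm
  choose ρ hρS hρ using fun a => hbs (e a).2
  let Φ : Matrix (Fin n) (Fin n) K := Matrix.of fun a i => phi T (ρ a) i
  have hΦ : LinearIndependent K Φ.row := by
    have h1 : Φ.row = (Subtype.val : b → Fin n → K) ∘ e := by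
      funext a
      exact hρ a
    rw [h1]
    exact hli.comp _ e.injective
  have hunit : IsUnit Φ.det :=
    (Matrix.isUnit_iff_isUnit_det Φ).mp (Matrix.linearIndependent_rows_iff_isUnit.mp hΦ)
  refine ⟨⟨ρ, Φ⁻¹, fun a a' haa => ?_, hρS, ?_, Matrix.nonsing_inv_mul _ hunit,
    Matrix.mul_nonsing_inv _ hunit⟩⟩
  · apply e.injective
    apply Subtype.ext
    rw [← hρ a, ← hρ a', haa]
  · exact Matrix.inv_apply_mem_subfield _ _ fun a i => phi_mem_closure _ _

namespace Frame

variable (F : Frame T)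

open Classical in
/-- The set of the vectors of the frame. -/
def range : Finset (MIdx n) := Finset.univ.image F.ρ

theorem mem_range {s : MIdx n} : s ∈ F.range ↔ ∃ a, F.ρ a = s := by
  simp [range]

theorem range_subset : F.range ⊆ submaxVecs T := fun s hs => by
  obtain ⟨a, rfl⟩ := F.mem_range.mp hs
  exact F.mem a

theorem card_range : F.range.card = n := by
  classical
  rw [range, Finset.card_image_of_injective _ F.injective, Finset.card_univ, Fintype.card_fin]

theorem sum_c_mul_phi (i j : Fin n) :
    ∑ a, F.c i a * phi T (F.ρ a) j = if i = j then 1 else 0 := by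
  have := congrFun (congrFun F.c_mul i) j
  rwa [Matrix.mul_apply, Matrix.one_apply] at this

theorem sum_phi_mul_c (a b : Fin n) :
    ∑ i, phi T (F.ρ a) i * F.c i b = if a = b then 1 else 0 := by
  have := congrFun (congrFun F.mul_c a) b
  rwa [Matrix.mul_apply, Matrix.one_apply] at this

end Frame

end DiffOp

/-! ### Triangular systems -/

/-- A system of equations `E_j = 0` that is triangular for a rank function, with diagonal
coefficients `u_j`, has exactly one solution, and this solution is obtained by ring operations. -/
theorem exists_solution_of_triangular {J X K : Type*} [Finite J] [Field K] (R : Subring (X → K))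
    (rank : J → ℕ) (E : J → X → (J → K) → K) (u : J → K) (hu : ∀ j, u j ≠ 0)
    (huR : ∀ j, (fun _ => (u j)⁻¹) ∈ R)
    (hE : ∀ j x z z', (∀ k, rank k < rank j → z k = z' k) →
      E j x z - E j x z' = u j * (z j - z' j))
    (hR : ∀ y : J → X → K, (∀ j, y j ∈ R) → ∀ j, (fun x => E j x fun k => y k x) ∈ R) :
    ∃ y : J → X → K, (∀ j, y j ∈ R) ∧ ∀ x z, (∀ j, E j x z = 0) ↔ z = fun j => y j x := by
  have key : ∀ N : ℕ, ∃ y : J → X → K, (∀ j, y j ∈ R) ∧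
      ∀ x z, (∀ j, rank j < N → E j x z = 0) ↔ ∀ j, rank j < N → z j = y j x := fun N => by
    induction N with
    | zero => exact ⟨0, fun _ => zero_mem _, by simp⟩
    | succ N ih =>
      obtain ⟨y, hy, hyE⟩ := ih
      obtain ⟨y', hpos, hneg⟩ : ∃ y' : J → X → K,
          (∀ j, rank j = N → y' j = fun x => y j x - (u j)⁻¹ * E j x fun k => y k x) ∧
          ∀ j, rank j ≠ N → y' j = y j :=
        ⟨fun j => if rank j = N then fun x => y j x - (u j)⁻¹ * E j x (fun k => y k x) else y j,
          fun j hj => if_pos hj, fun j hj => if_neg hj⟩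
      refine ⟨y', fun j => ?_, fun x z => ?_⟩
      · by_cases hjN : rank j = N
        · rw [hpos j hjN]
          exact sub_mem (hy j) (mul_mem (huR j) (hR y hy j))
        · rw [hneg j hjN]
          exact hy j
      · have hN : (∀ j, rank j < N → z j = y j x) → ∀ j, rank j = N →
            (E j x z = 0 ↔ z j = y j x - (u j)⁻¹ * E j x fun k => y k x) := by
          intro hlow j hj
          have h1 := hE j x z (fun k => y k x) fun k hk => hlow k (hj ▸ hk)
          have h2 := hu j
          constructor
          · intro h0
            rw [h0] at h1
            field_simp
            linear_combination -h1
          · intro h0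
            rw [h0] at h1
            field_simp at h1
            linear_combination h1
        constructor
        · intro h j hj
          have hlow := (hyE x z).mp fun j hj => h j (Nat.lt_succ_of_lt hj)
          by_cases hjN : rank j = N
          · rw [hpos j hjN]
            exact (hN hlow j hjN).mp (h j hj)
          · rw [hneg j hjN]
            exact hlow j (by omega)
        · intro h j hj
          have hlow : ∀ j, rank j < N → z j = y j x := fun j hj => by
            rw [h j (Nat.lt_succ_of_lt hj), hneg j hj.ne]
          by_cases hjN : rank j = N
          · refine (hN hlow j hjN).mpr ?_
            rw [h j hj, hpos j hjN]
          · exact (hyE x z).mpr hlow j (by omega)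
  have := Fintype.ofFinite J
  obtain ⟨y, hy, hyE⟩ := key (Finset.univ.sup rank + 1)
  have hrank : ∀ j, rank j < Finset.univ.sup rank + 1 := fun j =>
    Nat.lt_succ_of_le (Finset.le_sup (Finset.mem_univ j))
  exact ⟨y, hy, fun x z => by simpa [hrank, funext_iff] using hyE x z⟩

/-! ### Generalized incomplete factorizations -/

namespace DiffOp

variable {n : ℕ} {K : Type u} [Field K] {T : DiffOp n K}

theorem mem_lowAbove {v w : MIdx n} : w ∈ lowAbove T v ↔ w ∈ lowVecs T ∧ v < w := by
  simp [lowAbove]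

/-- A direction from a submaximal vector to a maximal one. -/
def subDir (T : DiffOp n K) (s : {s // s ∈ submaxVecs T}) : Fin n :=
  (exists_of_mem_submaxVecs s.2).choose

theorem subDir_spec (s : {s // s ∈ submaxVecs T}) : s.1 + MIdx.e (subDir T s) ∈ T.support :=
  (exists_of_mem_submaxVecs s.2).choose_spec

/-- A direction from a lower vector to a nonmaximal vector of the down set. -/
def lowDir (T : DiffOp n K) (v : MIdx n) (w : {w // w ∈ lowAbove T v}) : Fin n :=
  (exists_of_mem_lowVecs (mem_lowAbove.mp w.2).1).choose

theorem lowDir_spec {v : MIdx n} (w : {w // w ∈ lowAbove T v}) :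
    w.1 + MIdx.e (lowDir T v w) ∈ downVecs T ∧ w.1 + MIdx.e (lowDir T v w) ∉ T.support :=
  (exists_of_mem_lowVecs (mem_lowAbove.mp w.2).1).choose_spec

namespace Frame

variable (F : Frame T) (v : MIdx n)

open Classical in
/-- The submaximal vectors outside of the frame. -/
abbrev Extra : Type := {s // s ∈ submaxVecs T \ F.range}

theorem Extra.mem {F : Frame T} (s : F.Extra) : s.1 ∈ submaxVecs T := by
  classical
  exact (Finset.mem_sdiff.mp s.2).1

theorem Extra.notMem {F : Frame T} (s : F.Extra) : s.1 ∉ F.range := by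
  classical
  exact (Finset.mem_sdiff.mp s.2).2

theorem mem_range_or (s : MIdx n) (hs : s ∈ submaxVecs T) :
    (∃ a, F.ρ a = s) ∨ ∃ s' : F.Extra, s'.1 = s := by
  classical
  by_cases h : s ∈ F.range
  · exact Or.inl (F.mem_range.mp h)
  · exact Or.inr ⟨⟨s, Finset.mem_sdiff.mpr ⟨hs, h⟩⟩, rfl⟩

theorem card_extra : Fintype.card F.Extra = (submaxVecs T).card - n := by
  classical
  rw [Fintype.card_coe, Finset.card_sdiff_of_subset F.range_subset, F.card_range]

/-- The parameters of the factorization: a base parameter for every direction, one parameter for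
every submaximal vector outside of the frame, and one for every lower vector above `v`. -/
abbrev Param : Type := Fin n ⊕ F.Extra ⊕ {w // w ∈ lowAbove T v}

/-- The direction of an extra parameter. -/
def extraDir (s : F.Extra) : Fin n := subDir T ⟨s.1, s.mem⟩

theorem extraDir_spec (s : F.Extra) : s.1 + MIdx.e (F.extraDir s) ∈ T.support :=
  subDir_spec ⟨s.1, s.mem⟩

/-- The direction in which a parameter is used. -/
def paramDir : F.Param v → Fin n
  | .inl i => i
  | .inr (.inl s) => F.extraDir s
  | .inr (.inr w) => lowDir T v w

open Classical in
/-- The parameter used for direction `i` in the product for the maximal vector `m`: the one that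
belongs to `s = m - e_i` if there is one of direction `i`, and otherwise the base parameter. -/
def topParam (m : MIdx n) (i : Fin n) : F.Param v :=
  if h : ∃ s : F.Extra, s.1 + MIdx.e i = m ∧ F.extraDir s = i then .inr (.inl h.choose)
  else .inl i

open Classical in
/-- The parameter used for direction `i` in the product for the lower vector `w`. -/
def lowParam (w : {w // w ∈ lowAbove T v}) (i : Fin n) : F.Param v :=
  if lowDir T v w = i then .inr (.inr w) else .inl i

theorem topParam_extra (s : F.Extra) :
    F.topParam v (s.1 + MIdx.e (F.extraDir s)) (F.extraDir s) = .inr (.inl s) := by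
  have h : ∃ s' : F.Extra, s'.1 + MIdx.e (F.extraDir s) = s.1 + MIdx.e (F.extraDir s) ∧
      F.extraDir s' = F.extraDir s := ⟨s, rfl, rfl⟩
  rw [topParam, dif_pos h]
  have h1 : h.choose = s := Subtype.ext (add_right_cancel h.choose_spec.1)
  rw [h1]

theorem topParam_extra_of_ne (s : F.Extra) (i : Fin n) (hi : F.extraDir s ≠ i) :
    F.topParam v (s.1 + MIdx.e i) i = .inl i := by
  rw [topParam, dif_neg]
  rintro ⟨s', h1, h2⟩
  rw [Subtype.ext (add_right_cancel h1)] at h2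
  exact hi h2

theorem topParam_frame (a i : Fin n) : F.topParam v (F.ρ a + MIdx.e i) i = .inl i := by
  rw [topParam, dif_neg]
  rintro ⟨s, h1, -⟩
  exact s.notMem (F.mem_range.mpr ⟨a, (add_right_cancel h1).symm⟩)

theorem topParam_eq (m : MIdx n) (i : Fin n) : F.topParam v m i = .inl i ∨
    ∃ s : F.Extra, F.topParam v m i = .inr (.inl s) := by
  unfold topParam
  split_ifs with h
  · exact Or.inr ⟨_, rfl⟩
  · exact Or.inl rfl

theorem paramDir_topParam (m : MIdx n) (i : Fin n) : F.paramDir v (F.topParam v m i) = i := by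
  unfold topParam
  split_ifs with h
  · exact h.choose_spec.2
  · rfl

theorem paramDir_lowParam (w : {w // w ∈ lowAbove T v}) (i : Fin n) :
    F.paramDir v (F.lowParam v w i) = i := by
  unfold lowParam
  split_ifs with h
  · exact h
  · rfl

/-- The parameters, numbered. -/
def paramEquiv : F.Param v ≃ Fin (Fintype.card (F.Param v)) := Fintype.equivFin _

open Classical in
/-- The shape in which the parameter of a submaximal vector `s` outside of the frame occurs in one
product for a maximal vector that covers `s`, the parameter of a lower vector `w` occurs only in
the product that belongs to `w`, and all other factors have base parameters. -/
def shape : FactorShape T v where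
  r := Fintype.card (F.Param v)
  dir := fun k => F.paramDir v ((F.paramEquiv v).symm k)
  top := fun m => dirList (fun i => F.paramEquiv v (F.topParam v m i)) m
  low := fun w => if h : w ∈ lowAbove T v then
      dirList (fun i => F.paramEquiv v (F.lowParam v ⟨w, h⟩ i)) (w + MIdx.e (lowDir T v ⟨w, h⟩))
    else []
  cov := fun w => if h : w ∈ lowAbove T v then w + MIdx.e (lowDir T v ⟨w, h⟩) else w
  top_degree := fun m _ => listDegree_dirList _ (by simp [paramDir_topParam]) m
  cov_mem := fun w hw => by
    rw [dif_pos hw]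
    exact ⟨MIdx.covBy_iff.mpr ⟨_, rfl⟩, lowDir_spec ⟨w, hw⟩⟩
  low_degree := fun w hw => by
    rw [dif_pos hw, dif_pos hw]
    exact listDegree_dirList _ (by simp [paramDir_lowParam]) _

/-- The operator of the shape with given parameters. -/
def op (D : CommDerivations n K) (y : F.Param v → K) : DiffOp n K :=
  (F.shape v).op D fun k => y ((F.paramEquiv v).symm k)

variable (D : CommDerivations n K) (y : F.Param v → K)

/-- The product that belongs to the maximal vector `m`. -/
def topProd (m : MIdx n) : DiffOp n K :=
  D.factorProd (F.shape v).dir (fun k => y ((F.paramEquiv v).symm k)) ((F.shape v).top m)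

/-- The product that belongs to the lower vector `w`. -/
def lowProd (w : MIdx n) : DiffOp n K :=
  D.factorProd (F.shape v).dir (fun k => y ((F.paramEquiv v).symm k)) ((F.shape v).low w)

theorem op_apply (u : MIdx n) : F.op v D y u =
    ∑ m ∈ T.support, T m * F.topProd v D y m u + ∑ w ∈ lowAbove T v, F.lowProd v D y w u := by
  simp [op, FactorShape.op, topProd, lowProd]

theorem listDegree_top (m : MIdx n) :
    listDegree (F.shape v).dir ((F.shape v).top m) = m :=
  listDegree_dirList _ (by simp [shape, paramDir_topParam]) m

theorem shape_low (w : {w // w ∈ lowAbove T v}) : (F.shape v).low w.1 =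
    dirList (fun i => F.paramEquiv v (F.lowParam v w i)) (w.1 + MIdx.e (lowDir T v w)) := by
  simp only [shape]
  rw [dif_pos w.2]

theorem listDegree_low (w : {w // w ∈ lowAbove T v}) :
    listDegree (F.shape v).dir ((F.shape v).low w.1) = w.1 + MIdx.e (lowDir T v w) := by
  rw [shape_low]
  exact listDegree_dirList _ (by simp [shape, paramDir_lowParam]) _

theorem topProd_apply_of_not_le {m u : MIdx n} (h : ¬ u ≤ m) : F.topProd v D y m u = 0 :=
  D.factorProd_apply_of_not_le _ _ _ _ (by rwa [listDegree_top])

theorem topProd_apply_self (m : MIdx n) : F.topProd v D y m m = 1 := by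
  have := D.factorProd_apply_listDegree (F.shape v).dir
    (fun k => y ((F.paramEquiv v).symm k)) ((F.shape v).top m)
  rwa [listDegree_top] at this

theorem topProd_apply_below (s : MIdx n) (i : Fin n) :
    F.topProd v D y (s + MIdx.e i) s = ((s i : K) + 1) * y (F.topParam v (s + MIdx.e i) i) := by
  have := D.factorProd_dirList_apply (F.shape v).dir
    (π := fun j => F.paramEquiv v (F.topParam v (s + MIdx.e i) j))
    (by simp [shape, paramDir_topParam]) (fun k => y ((F.paramEquiv v).symm k)) s _ i rfl
  simpa [topProd, shape] using this

theorem lowProd_apply_of_not_le {w : {w // w ∈ lowAbove T v}} {u : MIdx n}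
    (h : ¬ u ≤ w.1 + MIdx.e (lowDir T v w)) : F.lowProd v D y w.1 u = 0 :=
  D.factorProd_apply_of_not_le _ _ _ _ (by rwa [listDegree_low])

theorem lowProd_apply_top (w : {w // w ∈ lowAbove T v}) :
    F.lowProd v D y w.1 (w.1 + MIdx.e (lowDir T v w)) = 1 := by
  have := D.factorProd_apply_listDegree (F.shape v).dir
    (fun k => y ((F.paramEquiv v).symm k)) ((F.shape v).low w.1)
  rwa [listDegree_low] at this

theorem lowProd_apply_self (w : {w // w ∈ lowAbove T v}) :
    F.lowProd v D y w.1 w.1 = ((w.1 (lowDir T v w) : K) + 1) * y (.inr (.inr w)) := by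
  have := D.factorProd_dirList_apply (F.shape v).dir
    (π := fun j => F.paramEquiv v (F.lowParam v w j))
    (by simp [shape, paramDir_lowParam]) (fun k => y ((F.paramEquiv v).symm k)) w.1 _
    (lowDir T v w) rfl
  rw [lowProd, shape_low]
  refine this.trans ?_
  rw [Equiv.symm_apply_apply, lowParam, if_pos rfl]

theorem topProd_congr {y y' : F.Param v → K} (m : MIdx n) (hb : ∀ i, y (.inl i) = y' (.inl i))
    (hx : ∀ s, y (.inr (.inl s)) = y' (.inr (.inl s))) :
    F.topProd v D y m = F.topProd v D y' m := by
  apply D.factorProd_congr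
  intro k hk
  obtain ⟨i, -, rfl⟩ := mem_dirList hk
  rw [Equiv.symm_apply_apply]
  rcases F.topParam_eq v m i with h | ⟨s, h⟩
  · rw [h, hb]
  · rw [h, hx]

theorem lowProd_congr {y y' : F.Param v → K} (w : {w // w ∈ lowAbove T v})
    (hb : ∀ i, y (.inl i) = y' (.inl i)) (hw : y (.inr (.inr w)) = y' (.inr (.inr w))) :
    F.lowProd v D y w.1 = F.lowProd v D y' w.1 := by
  apply D.factorProd_congr
  intro k hk
  rw [shape_low] at hk
  obtain ⟨i, -, rfl⟩ := mem_dirList hk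
  rw [Equiv.symm_apply_apply, lowParam]
  split_ifs
  · exact hw
  · exact hb i

/-- The parameter of `w` enters the coefficients of the product of `w` only at vectors `u ≤ w`. -/
theorem lowProd_apply_congr {y y' : F.Param v → K} (w : {w // w ∈ lowAbove T v}) {u : MIdx n}
    (hb : ∀ i, y (.inl i) = y' (.inl i)) (hu : ¬ u ≤ w.1) :
    F.lowProd v D y w.1 u = F.lowProd v D y' w.1 u := by
  by_cases hle : u ≤ w.1 + MIdx.e (lowDir T v w)
  · refine D.factorProd_apply_congr _ (lowDir T v w) (fun k hk hki => ?_) ?_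
    · rw [shape_low] at hk
      obtain ⟨i, -, rfl⟩ := mem_dirList hk
      have hi : lowDir T v w ≠ i := fun h => hki (by simp [shape, paramDir_lowParam, h])
      rw [Equiv.symm_apply_apply, lowParam, if_neg hi, hb]
    · rw [listDegree_low]
      by_contra hlt
      refine hu fun j => ?_
      have h1 := hle j
      by_cases hj : lowDir T v w = j
      · subst hj
        simp at hlt h1 ⊢
        omega
      · simpa [hj] using h1
  · rw [lowProd_apply_of_not_le _ _ _ _ hle, lowProd_apply_of_not_le _ _ _ _ hle]

theorem op_apply_of_notMem {u : MIdx n} (hu : u ∉ downVecs T) : F.op v D y u = 0 := by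
  rw [op_apply, Finset.sum_eq_zero, Finset.sum_eq_zero, add_zero]
  · intro w hw
    exact F.lowProd_apply_of_not_le v D y (w := ⟨w, hw⟩) fun h =>
      hu (downVecs_of_le (lowDir_spec ⟨w, hw⟩).1 h)
  · intro m hm
    rw [topProd_apply_of_not_le, mul_zero]
    exact fun h => hu (mem_downVecs.mpr ⟨m, hm, h⟩)

theorem op_apply_max (hT : IsTermAntichain T) {m : MIdx n} (hm : m ∈ T.support) :
    F.op v D y m = T m := by
  rw [op_apply, Finset.sum_eq_single_of_mem m hm, topProd_apply_self, Finset.sum_eq_zero,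
    mul_one, add_zero]
  · intro w hw
    refine F.lowProd_apply_of_not_le v D y (w := ⟨w, hw⟩) fun h => ?_
    have h1 := lowDir_spec ⟨w, hw⟩
    exact h1.2 (eq_of_mem_support_of_le hT hm h1.1 h ▸ hm)
  · intro m' hm' hne
    rw [topProd_apply_of_not_le, mul_zero]
    exact fun h => hne (eq_of_mem_support_of_le hT hm (support_subset_downVecs hm') h)

theorem op_apply_submax (hT : IsTermAntichain T) {s : MIdx n} (hs : s ∈ submaxVecs T) :
    F.op v D y s = ∑ i, phi T s i * y (F.topParam v (s + MIdx.e i) i) +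
      ∑ w ∈ lowAbove T v, F.lowProd v D y w s := by
  rw [op_apply, MIdx.sum_eq_sum_covers s]
  · congr 1
    refine Finset.sum_congr rfl fun i _ => ?_
    rw [topProd_apply_below, phi]
    ring
  · intro m hm hne
    rw [topProd_apply_of_not_le, mul_zero]
    intro hle
    obtain ⟨i, hi, -⟩ := exists_of_submaxVecs_lt hT hs (support_subset_downVecs hm)
      (lt_of_le_of_ne hle fun h => submaxVecs_notMem_support hT hs (h ▸ hm))
    exact hne i hi
  · intro i hi
    rw [Finsupp.notMem_support_iff.mp hi, zero_mul]

/-- The products of the lower vectors contribute only constants to the submaximal coefficients. -/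
theorem lowProd_apply_submax (hT : IsTermAntichain T) {s : MIdx n} (hs : s ∈ submaxVecs T)
    (y' : F.Param v → K) (w : {w // w ∈ lowAbove T v}) :
    F.lowProd v D y w.1 s = F.lowProd v D y' w.1 s := by
  have h1 := lowDir_spec w
  by_cases hle : s ≤ w.1 + MIdx.e (lowDir T v w)
  · rcases hle.eq_or_lt with rfl | hlt
    · rw [lowProd_apply_top, lowProd_apply_top]
    · obtain ⟨i, hi, hi'⟩ := exists_of_submaxVecs_lt hT hs h1.1 hlt
      exact absurd (hi ▸ hi') h1.2
  · rw [lowProd_apply_of_not_le _ _ _ _ hle, lowProd_apply_of_not_le _ _ _ _ hle]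

theorem op_apply_submax_sub (hT : IsTermAntichain T) {s : MIdx n} (hs : s ∈ submaxVecs T)
    (y' : F.Param v → K) : F.op v D y s - F.op v D y' s =
      ∑ i, phi T s i *
        (y (F.topParam v (s + MIdx.e i) i) - y' (F.topParam v (s + MIdx.e i) i)) := by
  have h : ∑ w ∈ lowAbove T v, F.lowProd v D y w s = ∑ w ∈ lowAbove T v, F.lowProd v D y' w s :=
    Finset.sum_congr rfl fun w hw => F.lowProd_apply_submax v D y hT hs y' ⟨w, hw⟩
  rw [op_apply_submax F v D y hT hs, op_apply_submax F v D y' hT hs, h, add_sub_add_right_eq_sub,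
    ← Finset.sum_sub_distrib]
  exact Finset.sum_congr rfl fun i _ => (mul_sub _ _ _).symm

theorem op_apply_low_sub (y' : F.Param v → K) (w : {w // w ∈ lowAbove T v})
    (hb : ∀ i, y (.inl i) = y' (.inl i)) (hx : ∀ s, y (.inr (.inl s)) = y' (.inr (.inl s)))
    (hw : ∀ w' : {w // w ∈ lowAbove T v}, w.1 < w'.1 → y (.inr (.inr w')) = y' (.inr (.inr w'))) :
    F.op v D y w.1 - F.op v D y' w.1 =
      ((w.1 (lowDir T v w) : K) + 1) * (y (.inr (.inr w)) - y' (.inr (.inr w))) := by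
  rw [op_apply, op_apply, Finset.sum_congr rfl fun m _ => by rw [F.topProd_congr v D m hb hx],
    add_sub_add_left_eq_sub, ← Finset.sum_sub_distrib, Finset.sum_eq_single_of_mem w.1 w.2,
    lowProd_apply_self, lowProd_apply_self, mul_sub]
  intro w' hw' hne
  by_cases hle : w.1 ≤ w'
  · rw [F.lowProd_congr v D ⟨w', hw'⟩ hb (hw ⟨w', hw'⟩ (lt_of_le_of_ne hle (Ne.symm hne))),
      sub_self]
  · rw [F.lowProd_apply_congr v D ⟨w', hw'⟩ hb hle, sub_self]

end Frame

end DiffOp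

namespace DiffOp

namespace Frame

variable {n : ℕ} {K : Type u} [Field K] {T : DiffOp n K}
variable (F : Frame T) (v : MIdx n) (D : CommDerivations n K)

/-- The equations for the parameters of an incomplete factorization of `L`: the remainder vanishes
at the vectors of the frame (in combinations that isolate the base parameters), at the other
submaximal vectors, and at the lower vectors above `v`. -/
def equation : F.Param v → DiffOp n K → (F.Param v → K) → K
  | .inl i, L, y => ∑ a, F.c i a * (F.op v D y (F.ρ a) - L (F.ρ a))
  | .inr (.inl s), L, y => F.op v D y s.1 - L s.1
  | .inr (.inr w), L, y => F.op v D y w.1 - L w.1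

/-- The order in which the equations determine the parameters. A lower vector comes after the lower
vectors above it: its rank grows with their number. -/
def paramRank : F.Param v → ℕ
  | .inl _ => 0
  | .inr (.inl _) => 1
  | .inr (.inr w) => 2 + (lowAbove T w.1 ∩ lowAbove T v).card

/-- The coefficient of a parameter in the equation that determines it. Characteristic zero makes it
nonzero, as it may be a multiplicity of a parameter in a product. -/
def pivot : F.Param v → K
  | .inl _ => 1
  | .inr (.inl s) => phi T s.1 (F.extraDir s)
  | .inr (.inr w) => (w.1 (lowDir T v w) : K) + 1

theorem pivot_ne_zero [CharZero K] (j : F.Param v) : F.pivot v j ≠ 0 := by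
  rcases j with i | s | w
  · exact one_ne_zero
  · exact phi_apply_ne_zero (F.extraDir_spec s)
  · exact Nat.cast_add_one_ne_zero _

theorem pivot_mem_closure (j : F.Param v) : F.pivot v j ∈ Subfield.closure (Set.range T) := by
  rcases j with i | s | w
  · exact one_mem _
  · exact phi_mem_closure _ _
  · exact add_mem (natCast_mem _ _) (one_mem _)

theorem paramRank_lt {w w' : {w // w ∈ lowAbove T v}} (h : w.1 < w'.1) :
    F.paramRank v (.inr (.inr w')) < F.paramRank v (.inr (.inr w)) := by
  classical
  refine Nat.add_lt_add_left (Finset.card_lt_card ⟨fun u hu => ?_, fun hsub => ?_⟩) 2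
  · obtain ⟨h1, h2⟩ := Finset.mem_inter.mp hu
    obtain ⟨h3, h4⟩ := mem_lowAbove.mp h1
    exact Finset.mem_inter.mpr ⟨mem_lowAbove.mpr ⟨h3, h.trans h4⟩, h2⟩
  · have h1 : w'.1 ∈ lowAbove T w.1 ∩ lowAbove T v := Finset.mem_inter.mpr
      ⟨mem_lowAbove.mpr ⟨(mem_lowAbove.mp w'.2).1, h⟩, w'.2⟩
    exact lt_irrefl _ (mem_lowAbove.mp (Finset.mem_inter.mp (hsub h1)).1).2

theorem equation_sub (hT : IsTermAntichain T) (j : F.Param v) (L : DiffOp n K)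
    (y y' : F.Param v → K) (h : ∀ k, F.paramRank v k < F.paramRank v j → y k = y' k) :
    F.equation v D j L y - F.equation v D j L y' = F.pivot v j * (y j - y' j) := by
  rcases j with i | s | w
  · have h1 : ∀ a, F.op v D y (F.ρ a) - F.op v D y' (F.ρ a) =
        ∑ j, phi T (F.ρ a) j * (y (.inl j) - y' (.inl j)) := fun a => by
      rw [F.op_apply_submax_sub v D y hT (F.mem a)]
      simp only [topParam_frame]
    simp only [equation, pivot]
    rw [← Finset.sum_sub_distrib]
    simp only [← mul_sub, sub_sub_sub_cancel_right, h1, Finset.mul_sum]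
    rw [Finset.sum_comm]
    simp only [← mul_assoc, ← Finset.sum_mul, F.sum_c_mul_phi]
    simp
  · simp only [equation, pivot, sub_sub_sub_cancel_right]
    rw [F.op_apply_submax_sub v D y hT s.mem, Finset.sum_eq_single (F.extraDir s),
      topParam_extra]
    · intro i _ hi
      rw [F.topParam_extra_of_ne v s i (Ne.symm hi), h _ (by simp [paramRank]), sub_self, mul_zero]
    · simp
  · simp only [equation, pivot, sub_sub_sub_cancel_right]
    exact F.op_apply_low_sub v D y y' w (fun i => h _ (by simp [paramRank]))
      (fun s => h _ (by simp only [paramRank]; omega)) fun w' hw' => h _ (F.paramRank_lt v hw')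

theorem forall_equation_eq_zero_iff (hT : IsTermAntichain T) {L : DiffOp n K}
    (hL : L ∈ MaxGen T) (y : F.Param v → K) :
    (∀ j, F.equation v D j L y = 0) ↔ L - F.op v D y ∈ remainderClass T v := by
  rw [mem_maxGen_iff hT] at hL
  have hop : ∀ u, F.op v D y u - L u = 0 ↔ (L - F.op v D y) u = 0 := fun u => by
    rw [Finsupp.sub_apply, sub_eq_zero, sub_eq_zero, eq_comm]
  constructor
  · intro h u hu
    have hd : u ∈ downVecs T := by
      by_contra hd
      apply hu
      rw [Finsupp.sub_apply, F.op_apply_of_notMem v D y hd, sub_zero]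
      by_contra hne
      exact hd (hL.2 u hne)
    have hM : u ∉ T.support := fun hM => hu (by
      rw [Finsupp.sub_apply, F.op_apply_max v D y hT hM, hL.1 u hM, sub_self])
    have hS : u ∉ submaxVecs T := fun hS => by
      rcases F.mem_range_or u hS with ⟨a, rfl⟩ | ⟨s, rfl⟩
      · refine hu ((hop _).mp ?_)
        have h1 : ∑ i, phi T (F.ρ a) i * F.equation v D (.inl i) L y =
            F.op v D y (F.ρ a) - L (F.ρ a) := by
          simp only [equation, Finset.mul_sum]
          rw [Finset.sum_comm]
          simp only [← mul_assoc, ← Finset.sum_mul, F.sum_phi_mul_c]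
          simp
        rw [← h1]
        exact Finset.sum_eq_zero fun i _ => by rw [h, mul_zero]
      · exact hu ((hop _).mp (h (.inr (.inl s))))
    have hV := mem_lowVecs.mpr ⟨hd, hM, hS⟩
    exact ⟨hV, fun hvu => hu ((hop u).mp (h (.inr (.inr ⟨u, mem_lowAbove.mpr ⟨hV, hvu⟩⟩))))⟩
  · intro h j
    have hS : ∀ s ∈ submaxVecs T, F.op v D y s - L s = 0 := fun s hs => (hop s).mpr (by
      by_contra hne
      exact (mem_lowVecs.mp (h s hne).1).2.2 hs)
    rcases j with i | s | w
    · exact Finset.sum_eq_zero fun a _ => by rw [hS _ (F.mem a), mul_zero]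
    · exact hS _ s.mem
    · exact (hop _).mpr (by
        by_contra hne
        exact (h w.1 hne).2 (mem_lowAbove.mp w.2).2)

variable [CharZero K] {v}

theorem op_mem_exprRing (hT : IsTermAntichain T) {A : Set (MIdx n)} (hA : ∀ m ∈ T.support, m ∈ A)
    {y : F.Param v → DiffOp n K → K} (hy : ∀ j, y j ∈ CoeffExpr.exprRing D (MaxGen T) A)
    (u : MIdx n) :
    (fun L => F.op v D (fun j => y j L) u) ∈ CoeffExpr.exprRing D (MaxGen T) A := by
  have hprod : ∀ l, (fun L => D.factorProd (F.shape v).dir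
      (fun k => y ((F.paramEquiv v).symm k) L) l u) ∈ CoeffExpr.exprRing D (MaxGen T) A :=
    fun l => CoeffExpr.factorProd_mem_exprRing (F.shape v).dir
      (p := fun k => y ((F.paramEquiv v).symm k)) (fun k _ => hy _) u
  have h : (fun L => F.op v D (fun j => y j L) u) =
      ∑ m ∈ T.support, (fun _ => T m) * (fun L => F.topProd v D (fun j => y j L) m u) +
        ∑ w ∈ lowAbove T v, fun L => F.lowProd v D (fun j => y j L) w u := by
    funext L
    simp [op_apply]
  rw [h]
  refine add_mem (sum_mem fun m _ => mul_mem ?_ (hprod _)) (sum_mem fun w _ => hprod _)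
  exact CoeffExpr.const_mem_exprRing hT hA (Subfield.subset_closure ⟨m, rfl⟩)

/-- The parameters of the factorization are determined by the operator, and they are given by
expressions in the coefficients. -/
theorem exists_parameters (hT : IsTermAntichain T) {A : Set (MIdx n)}
    (hM : ∀ m ∈ T.support, m ∈ A) (hS : ∀ s ∈ submaxVecs T, s ∈ A) (hv : ∀ w, v < w → w ∈ A) :
    ∃ y : F.Param v → DiffOp n K → K, (∀ j, y j ∈ CoeffExpr.exprRing D (MaxGen T) A) ∧
      ∀ L ∈ MaxGen T, ∀ z, L - F.op v D z ∈ remainderClass T v ↔ z = fun j => y j L := by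
  obtain ⟨y, hy, hyE⟩ := exists_solution_of_triangular (CoeffExpr.exprRing D (MaxGen T) A)
    (F.paramRank v) (F.equation v D) (F.pivot v) (F.pivot_ne_zero v)
    (fun j => CoeffExpr.const_mem_exprRing hT hM (inv_mem (F.pivot_mem_closure v j)))
    (F.equation_sub v D hT) (fun y hy j => by
      have hop := F.op_mem_exprRing D hT hM hy
      rcases j with i | s | w
      · have h : (fun L => F.equation v D (.inl i) L fun k => y k L) = ∑ a, (fun _ => F.c i a) *
            ((fun L => F.op v D (fun k => y k L) (F.ρ a)) - fun L => L (F.ρ a)) := by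
          funext L
          simp [equation]
        rw [h]
        exact sum_mem fun a _ => mul_mem (CoeffExpr.const_mem_exprRing hT hM (F.c_mem i a))
          (sub_mem (hop _) (CoeffExpr.coeff_mem_exprRing (hS _ (F.mem a))))
      · exact sub_mem (hop _) (CoeffExpr.coeff_mem_exprRing (hS _ s.mem))
      · exact sub_mem (hop _) (CoeffExpr.coeff_mem_exprRing (hv _ (mem_lowAbove.mp w.2).2)))
  exact ⟨y, hy, fun L hL z => (F.forall_equation_eq_zero_iff v D hT hL z).symm.trans (hyE L z)⟩

end Frame

end DiffOp

/-! ### Invariants from factorizations -/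

open DiffOp

section Upward

variable {n : ℕ} {K : Type u} [Field K] {D : CommDerivations n K} {T : DiffOp n K} {v : MIdx n}

theorem CommDerivations.conj_factorShape_op (S : FactorShape T v) {w : K} {h : Fin n → K}
    (hw : w ≠ 0) (hh : ∀ i, D.d i w = h i * w) (p : Fin S.r → K) :
    D.conj w (S.op D p) = S.op D fun k => p k + h (S.dir k) := by
  simp only [FactorShape.op, ← D.conjLinear_apply, map_add, map_sum, map_smul]
  simp only [D.conjLinear_apply, D.conj_factorProd S.dir p hw hh]

theorem CommDerivations.conj_mem_remainderClass (hT : IsTermAntichain T) {w : K} {h : Fin n → K}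
    (hw : w ≠ 0) (hh : ∀ i, D.d i w = h i * w) {N : DiffOp n K} (hN : N ∈ remainderClass T v) :
    D.conj w N ∈ remainderClass T v := by
  intro u hu
  obtain ⟨u', hu', hle⟩ := D.exists_le_of_conj_apply_ne_zero hw hh N u hu
  exact ⟨lowVecs_of_le hT (hN u' hu').1 hle, fun hvu => (hN u' hu').2 (hvu.trans_le hle)⟩

/-- The remainder of a factorization is conjugated along with the operator, and its coefficient at
`v` is a maximal one, so that it does not change. -/
theorem IsFactorizationRemainder.value_eq [CharZero K] (hT : IsTermAntichain T) {I : CoeffExpr n}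
    (hI : IsFactorizationRemainder D T v I) {w : K} {h : Fin n → K} (hw : w ≠ 0)
    (hh : ∀ i, D.d i w = h i * w) {L : DiffOp n K} (hL : L ∈ MaxGen T) :
    I.value D (D.conj w L) = I.value D L := by
  obtain ⟨S, hS⟩ := hI
  obtain ⟨⟨p, hp, -⟩, hval⟩ := hS L hL
  have h1 : D.conj w L - S.op D (fun k => p k + h (S.dir k)) = D.conj w (L - S.op D p) := by
    rw [← D.conj_factorShape_op S hw hh]
    exact ((D.conjLinear w).map_sub L (S.op D p)).symm
  have h2 : D.conj w L - S.op D (fun k => p k + h (S.dir k)) ∈ remainderClass T v :=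
    h1 ▸ D.conj_mem_remainderClass hT hw hh hp
  rw [(hS _ (D.conj_mem_maxGen hT hw hh hL)).2 _ h2, hval p hp, h1,
    D.conj_apply_of_forall_not_lt hw hh]
  intro u hu
  by_contra hne
  exact (hp u hne).2 hu

theorem DiffOp.Frame.exists_upwardInvariant [CharZero K] (F : Frame T) (hT : IsTermAntichain T)
    (v : MIdx n) : ∃ I : CoeffExpr n, I.IsDefinedOn D (MaxGen T) ∧ IsUpwardExpr D T v I ∧
      IsFactorizationRemainder D T v I := by
  let A : Set (MIdx n) := {w | v < w ∨ w ∈ T.support ∨ w ∈ submaxVecs T}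
  obtain ⟨y, hy, hyL⟩ := F.exists_parameters (v := v) D hT (A := A) (fun m hm => Or.inr (Or.inl hm))
    (fun s hs => Or.inr (Or.inr hs)) (fun w hw => Or.inl hw)
  obtain ⟨E, hEA, hEd, hE⟩ := F.op_mem_exprRing D hT (fun m hm => Or.inr (Or.inl hm)) hy v
  obtain ⟨I, -, hId, hI⟩ : (fun L => L v - E.value D L) ∈
      CoeffExpr.exprRing D (MaxGen T) Set.univ :=
    sub_mem (CoeffExpr.coeff_mem_exprRing trivial) ⟨E, fun _ _ => trivial, hEd, fun _ _ => rfl⟩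
  let e : F.Param v ≃ Fin (F.shape v).r := F.paramEquiv v
  have huniq : ∀ L ∈ MaxGen T, ∀ p : Fin (F.shape v).r → K,
      L - (F.shape v).op D p ∈ remainderClass T v ↔ p = fun k => y (e.symm k) L := by
    intro L hL p
    have h1 := hyL L hL fun j => p (e j)
    have h2 : F.op v D (fun j => p (e j)) = (F.shape v).op D p := by
      change (F.shape v).op D (fun k => p (e (e.symm k))) = _
      simp only [Equiv.apply_symm_apply]
    rw [h2] at h1
    rw [h1]
    constructor
    · intro h
      funext k
      have := congrFun h (e.symm k)
      rwa [Equiv.apply_symm_apply] at this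
    · rintro rfl
      simp only [Equiv.symm_apply_apply]
  refine ⟨I, hId, ⟨E, hEA, hEd, hI⟩, F.shape v, fun L hL => ⟨⟨_, (huniq L hL _).mpr rfl,
    fun p hp => (huniq L hL p).mp hp⟩, fun p hp => ?_⟩⟩
  have h1 : I.value D L = L v - F.op v D (fun j => y j L) v :=
    (hI L hL).trans (congrArg (L v - ·) (hE L hL))
  rw [h1, (huniq L hL p).mp hp]
  rfl

end Upward

/-! ### Linear combinations of submaximal coefficients -/

section CoeffComb

open DiffOp

variable {n : ℕ} {K : Type u} [Field K] {D : CommDerivations n K} {T : DiffOp n K}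

theorem coeffComb_eq (c : MIdx n →₀ K) (L : DiffOp n K) :
    coeffComb c L = Finsupp.linearCombination K L c := rfl

theorem coeffComb_conj (hT : IsTermAntichain T) {w : K} {h : Fin n → K} (hw : w ≠ 0)
    (hh : ∀ i, D.d i w = h i * w) {L : DiffOp n K} (hL : L ∈ MaxGen T) {c : MIdx n →₀ K}
    (hc : c.support ⊆ submaxVecs T) : coeffComb c (D.conj w L) =
      coeffComb c L + Finsupp.linearCombination K (phi T) c ⬝ᵥ h := by
  simp only [coeffComb, Finsupp.linearCombination_apply, Finsupp.sum, sum_dotProduct,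
    smul_dotProduct, ← Finset.sum_add_distrib]
  refine Finset.sum_congr rfl fun s hs => ?_
  rw [D.conj_apply_submax hT hw hh hL (hc hs), mul_add, smul_eq_mul]

theorem coeffComb_mem_exprRing [CharZero K] (hT : IsTermAntichain T) {c : MIdx n →₀ K}
    (hc : ∀ v, c v ∈ Subfield.closure (Set.range T)) :
    coeffComb c ∈ CoeffExpr.exprRing D (MaxGen T) Set.univ := by
  have h : coeffComb c = ∑ v ∈ c.support, (fun _ => c v) * fun L => L v := by
    funext L
    simp [coeffComb, Finsupp.sum]
  rw [h]
  exact sum_mem fun v _ => mul_mem (CoeffExpr.const_mem_exprRing hT (fun _ _ => trivial) (hc v))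
    (CoeffExpr.coeff_mem_exprRing trivial)

namespace DiffOp.Frame

variable (F : Frame T)

/-- The combination of frame vectors whose image under `φ` is `e_i`. -/
def frameComb (i : Fin n) : MIdx n →₀ K := ∑ a, Finsupp.single (F.ρ a) (F.c i a)

/-- The relation between `φ(s)` and the `φ`-images of the frame. -/
def extraComb (s : F.Extra) : MIdx n →₀ K :=
  Finsupp.single s.1 1 - ∑ i, phi T s.1 i • F.frameComb i

theorem frameComb_apply_of_notMem (i : Fin n) {u : MIdx n} (hu : u ∉ F.range) :
    F.frameComb i u = 0 := by
  rw [frameComb, Finsupp.finsetSum_apply]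
  exact Finset.sum_eq_zero fun a _ =>
    Finsupp.single_eq_of_ne fun h => hu (F.mem_range.mpr ⟨a, h.symm⟩)

theorem extraComb_apply (s : F.Extra) (u : MIdx n) : F.extraComb s u =
    Finsupp.single s.1 (1 : K) u - ∑ i, phi T s.1 i * F.frameComb i u := by
  simp [extraComb]

theorem frameComb_support (i : Fin n) : (F.frameComb i).support ⊆ submaxVecs T := fun u hu => by
  by_contra hS
  exact Finsupp.mem_support_iff.mp hu
    (F.frameComb_apply_of_notMem i fun h => hS (F.range_subset h))

theorem extraComb_support (s : F.Extra) : (F.extraComb s).support ⊆ submaxVecs T := fun u hu => by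
  by_contra hS
  apply Finsupp.mem_support_iff.mp hu
  have hne : u ≠ s.1 := by
    rintro rfl
    exact hS s.mem
  rw [extraComb_apply, Finsupp.single_eq_of_ne hne, zero_sub, neg_eq_zero]
  exact Finset.sum_eq_zero fun i _ => by
    rw [F.frameComb_apply_of_notMem i fun h => hS (F.range_subset h), mul_zero]

theorem frameComb_mem (i : Fin n) (u : MIdx n) :
    F.frameComb i u ∈ Subfield.closure (Set.range T) := by
  rw [frameComb, Finsupp.finsetSum_apply]
  refine sum_mem fun a _ => ?_
  rw [Finsupp.single_apply]
  split_ifs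
  · exact F.c_mem i a
  · exact zero_mem _

theorem extraComb_mem (s : F.Extra) (u : MIdx n) :
    F.extraComb s u ∈ Subfield.closure (Set.range T) := by
  rw [extraComb_apply, Finsupp.single_apply]
  refine sub_mem ?_ (sum_mem fun i _ => mul_mem (phi_mem_closure _ _) (F.frameComb_mem i u))
  split_ifs
  · exact one_mem _
  · exact zero_mem _

theorem linearCombination_frameComb (i : Fin n) :
    Finsupp.linearCombination K (phi T) (F.frameComb i) = Pi.single i 1 := by
  funext j
  simp only [frameComb, map_sum, Finsupp.linearCombination_single, Finset.sum_apply, Pi.smul_apply,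
    smul_eq_mul, F.sum_c_mul_phi, Pi.single_apply]
  exact if_congr eq_comm rfl rfl

theorem linearCombination_extraComb (s : F.Extra) :
    Finsupp.linearCombination K (phi T) (F.extraComb s) = 0 := by
  funext j
  simp [extraComb, linearCombination_frameComb, Finset.sum_apply, Pi.single_apply]

theorem linearIndependent_extraComb : LinearIndependent K F.extraComb := by
  rw [Fintype.linearIndependent_iff]
  intro g hg s
  have h1 := DFunLike.congr_fun hg s.1
  rw [Finsupp.finsetSum_apply, Finset.sum_eq_single s] at h1
  · simpa [extraComb_apply, F.frameComb_apply_of_notMem _ s.notMem] using h1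
  · intro s' _ hne
    have h2 : s.1 ≠ s'.1 := fun h => hne (Subtype.ext h.symm)
    simp [extraComb_apply, F.frameComb_apply_of_notMem _ s.notMem, Finsupp.single_eq_of_ne h2]
  · simp

theorem coeffComb_frameComb (i : Fin n) (L : DiffOp n K) :
    coeffComb (F.frameComb i) L = ∑ a, F.c i a * L (F.ρ a) := by
  simp [coeffComb_eq, frameComb]

theorem coeffComb_extraComb (s : F.Extra) (L : DiffOp n K) : coeffComb (F.extraComb s) L =
    L s.1 - ∑ i, phi T s.1 i * coeffComb (F.frameComb i) L := by
  simp [coeffComb_eq, extraComb]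

/-- The combinations determine all submaximal coefficients. -/
theorem eq_on_submaxVecs {L L' : DiffOp n K}
    (hE : ∀ i, coeffComb (F.frameComb i) L = coeffComb (F.frameComb i) L')
    (hX : ∀ s, coeffComb (F.extraComb s) L = coeffComb (F.extraComb s) L') {s : MIdx n}
    (hs : s ∈ submaxVecs T) : L s = L' s := by
  rcases F.mem_range_or s hs with ⟨b, rfl⟩ | ⟨s, rfl⟩
  · have h : ∀ L : DiffOp n K,
        ∑ i, phi T (F.ρ b) i * coeffComb (F.frameComb i) L = L (F.ρ b) := fun L => by
      simp only [coeffComb_frameComb, Finset.mul_sum]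
      rw [Finset.sum_comm]
      simp only [← mul_assoc, ← Finset.sum_mul, F.sum_phi_mul_c]
      simp
    rw [← h L, ← h L']
    simp only [hE]
  · have h := hX s
    rw [coeffComb_extraComb, coeffComb_extraComb] at h
    simpa only [hE, sub_left_inj] using h

end DiffOp.Frame

end CoeffComb

/-! ### The complete set of invariants -/

section Complete

open DiffOp

variable {n : ℕ} {K : Type u} [Field K] [CharZero K] {D : CommDerivations n K} {T : DiffOp n K}

theorem CoeffExpr.value_congr {I : CoeffExpr n} {A : Set (MIdx n)} (hI : I.InvolvesOnly A)
    {L L' : DiffOp n K} (h : ∀ u ∈ A, L u = L' u) : I.value D L = I.value D L' := by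
  have key : ∀ p : MvPolynomial (MIdx n × MIdx n) ℚ, (∀ x ∈ p.vars, x.1 ∈ A) →
      polyValue D p L = polyValue D p L' := fun p hp =>
    MvPolynomial.eval₂Hom_congr' rfl (fun x hx _ => by rw [h _ (hp x hx)]) rfl
  rw [value, value, key _ fun x hx => hI x (Or.inl hx), key _ fun x hx => hI x (Or.inr hx)]

/-- The upward invariants determine the lower coefficients from the top down. -/
theorem eq_of_upward (hT : IsTermAntichain T) {I : MIdx n → CoeffExpr n}
    (hI : ∀ v ∈ lowVecs T, IsUpwardExpr D T v (I v)) {L L' : DiffOp n K} (hL : L ∈ MaxGen T)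
    (hL' : L' ∈ MaxGen T) (hS : ∀ s ∈ submaxVecs T, L s = L' s)
    (hV : ∀ v ∈ lowVecs T, (I v).value D L = (I v).value D L') : L = L' := by
  have hM := (mem_maxGen_iff hT).mp hL
  have hM' := (mem_maxGen_iff hT).mp hL'
  have hMM : ∀ m ∈ T.support, L m = L' m := fun m hm => (hM.1 m hm).trans (hM'.1 m hm).symm
  have hd : ∀ v, v ∉ downVecs T → L v = L' v := fun v hv => by
    have h1 : L v = 0 := by_contra fun h => hv (hM.2 v h)
    have h2 : L' v = 0 := by_contra fun h => hv (hM'.2 v h)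
    rw [h1, h2]
  -- Induction on the number of lower vectors above `v`.
  have hlow : ∀ k : ℕ, ∀ v, (lowAbove T v).card = k → v ∈ lowVecs T → L v = L' v := by
    intro k
    induction k using Nat.strong_induction_on with
    | _ k ih =>
      intro v hk hv
      obtain ⟨E, hE, -, hval⟩ := hI v hv
      have h1 : E.value D L = E.value D L' := CoeffExpr.value_congr hE (by
        rintro w (hw | hw | hw)
        · by_cases hwd : w ∈ downVecs T
          · by_cases hwM : w ∈ T.support
            · exact hMM w hwM
            by_cases hwS : w ∈ submaxVecs T
            · exact hS w hwS
            have hwV := mem_lowVecs.mpr ⟨hwd, hwM, hwS⟩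
            refine ih _ ?_ w rfl hwV
            rw [← hk]
            refine Finset.card_lt_card ⟨fun u hu => ?_, fun hsub => ?_⟩
            · obtain ⟨h1, h2⟩ := mem_lowAbove.mp hu
              exact mem_lowAbove.mpr ⟨h1, hw.trans h2⟩
            · exact lt_irrefl _ (mem_lowAbove.mp (hsub (mem_lowAbove.mpr ⟨hwV, hw⟩))).2
          · exact hd w hwd
        · exact hMM w hw
        · exact hS w hw)
      have h2 := hV v hv
      rw [hval L hL, hval L' hL', h1] at h2
      exact sub_left_injective h2
  ext v
  by_cases hvd : v ∈ downVecs T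
  · by_cases hvM : v ∈ T.support
    · exact hMM v hvM
    by_cases hvS : v ∈ submaxVecs T
    · exact hS v hvS
    exact hlow _ v rfl (mem_lowVecs.mpr ⟨hvd, hvM, hvS⟩)
  · exact hd v hvd

end Complete

open DiffOp in
theorem mainTheorem1 {n : ℕ} {K : Type u} [Field K] [CharZero K]
    (D : CommDerivations n K) (hK : D.IsDifferentiallyClosed)
    (T : DiffOp n K) (hT : DiffOp.IsTermAntichain T)
    (hframed : DiffOp.IsFramed T) (hflat : DiffOp.IsApproximatelyFlat T) :
    ∃ (Iextra : Fin ((DiffOp.submaxVecs T).card - n) → CoeffExpr n)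
      (Icomp : Fin n → Fin n → CoeffExpr n)
      (Iup : MIdx n → CoeffExpr n),
      AreExtraInvariants D T Iextra ∧
      AreCompatibilityInvariants D T Icomp ∧
      (∀ v ∈ DiffOp.lowVecs T,
        IsUpwardExpr D T v (Iup v) ∧ IsFactorizationRemainder D T v (Iup v)) ∧
      IsCompleteSetOfInvariants D (DiffOp.MaxGen T)
        (CoeffExpr.coeff '' (T.support : Set (MIdx n)) ∪ Set.range Iextra ∪
          {J | ∃ i j, i < j ∧ J = Icomp i j} ∪ Iup '' (DiffOp.lowVecs T : Set (MIdx n))) := by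
  obtain ⟨F⟩ := hframed.nonempty_frame
  choose IX _ hIXd hIX using fun s : F.Extra =>
    CoeffExpr.mem_exprRing.mp (coeffComb_mem_exprRing (D := D) hT (F.extraComb_mem s))
  choose IC _ hICd hIC using fun i j : Fin n => CoeffExpr.mem_exprRing.mp (sub_mem
    (CoeffExpr.d_mem_exprRing (coeffComb_mem_exprRing (D := D) hT (F.frameComb_mem i)) j)
    (CoeffExpr.d_mem_exprRing (coeffComb_mem_exprRing (D := D) hT (F.frameComb_mem j)) i))
  choose IU hIUd hIUE hIUF using fun v => F.exists_upwardInvariant (D := D) hT v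
  let e : Fin ((submaxVecs T).card - n) ≃ F.Extra :=
    (Fintype.equivFinOfCardEq F.card_extra).symm
  refine ⟨fun k => IX (e k), IC, IU, ?_, ?_, fun v _ => ⟨hIUE v, hIUF v⟩, ?_, ?_, ?_⟩
  · exact ⟨fun k => F.extraComb (e k), F.linearIndependent_extraComb.comp e e.injective, fun k =>
      ⟨F.extraComb_support _, F.linearCombination_extraComb _, hIX (e k)⟩⟩
  · exact ⟨F.frameComb, fun i => ⟨F.frameComb_support i, F.linearCombination_frameComb i⟩,
      fun i j _ => hIC i j⟩
  · refine (((Finset.finite_toSet _).image _).union (Set.finite_range _)).union ?_ |>.union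
      ((Finset.finite_toSet _).image _)
    refine (Set.finite_range fun x : Fin n × Fin n => IC x.1 x.2).subset ?_
    rintro _ ⟨i, j, -, rfl⟩
    exact ⟨(i, j), rfl⟩
  · have hframe : ∀ {w g : K}, w ≠ 0 → (∀ i, D.d i w = D.d i g * w) → ∀ L ∈ MaxGen T, ∀ i,
        coeffComb (F.frameComb i) (D.conj w L) = coeffComb (F.frameComb i) L + D.d i g := by
      intro w g hw hh L hL i
      rw [coeffComb_conj hT hw hh hL (F.frameComb_support i), F.linearCombination_frameComb,
        single_one_dotProduct]
    rintro J (((⟨m, hm, rfl⟩ | ⟨k, rfl⟩) | ⟨i, j, -, rfl⟩) | ⟨v, -, rfl⟩)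
    · refine ⟨fun L _ => by simp [CoeffExpr.polyValue, CoeffExpr.coeff], fun L hL L' hL' _ => ?_⟩
      simp only [CoeffExpr.value, CoeffExpr.polyValue, CoeffExpr.coeff, MvPolynomial.aeval_X,
        CommDerivations.partialD_zero]
      rw [((mem_maxGen_iff hT).mp hL).1 m hm, ((mem_maxGen_iff hT).mp hL').1 m hm, map_one, map_one]
    · refine ⟨hIXd _, ?_⟩
      rintro L hL L' hL' ⟨g, w, hw, hh, rfl⟩
      rw [hIX _ L hL, hIX _ _ hL']
      change _ = coeffComb _ (D.conj w L)
      rw [coeffComb_conj hT hw hh hL (F.extraComb_support _), F.linearCombination_extraComb,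
        zero_dotProduct, add_zero]
    · refine ⟨hICd i j, ?_⟩
      rintro L hL L' hL' ⟨g, w, hw, hh, rfl⟩
      rw [hIC i j L hL, hIC i j _ hL']
      change D.d j _ - D.d i _ =
        D.d j (coeffComb _ (D.conj w L)) - D.d i (coeffComb _ (D.conj w L))
      rw [hframe hw hh L hL, hframe hw hh L hL, map_add, map_add, D.comm i j]
      ring
    · refine ⟨hIUd v, ?_⟩
      rintro L hL L' hL' ⟨g, w, hw, hh, rfl⟩
      exact ((hIUF v).value_eq hT hw hh hL).symm
  · intro L hL L' hL' hJ
    -- The only possible gradient of `g` is the difference of the values of the `E_i`.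
    let h : Fin n → K := fun i => coeffComb (F.frameComb i) L' - coeffComb (F.frameComb i) L
    have hcompat : ∀ i j, i < j → D.d i (h j) = D.d j (h i) := fun i j hij => by
      have h1 := hJ (IC i j) (Or.inl (Or.inr ⟨i, j, hij, rfl⟩))
      rw [hIC i j L hL, hIC i j L' hL'] at h1
      change D.d j _ - D.d i _ = D.d j _ - D.d i _ at h1
      simp only [h, map_sub]
      linear_combination h1
    have hclosed : ∀ i j, D.d i (h j) = D.d j (h i) := fun i j => by
      rcases lt_trichotomy i j with hij | rfl | hij
      · exact hcompat i j hij
      · rfl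
      · exact (hcompat j i hij).symm
    obtain ⟨g, hg⟩ := hK.exists_potential h hclosed
    obtain ⟨w, hw, hwh⟩ := hK.exists_exponential h hclosed
    have hmem := D.conj_mem_maxGen hT hw hwh hL
    refine ⟨g, w, hw, fun i => by rw [hwh i, hg i], ?_⟩
    refine (eq_of_upward hT (fun v _ => hIUE v) hmem hL' (fun s hs => ?_) fun v hv => ?_).symm
    · refine F.eq_on_submaxVecs (fun i => ?_) (fun s => ?_) hs
      · rw [coeffComb_conj hT hw hwh hL (F.frameComb_support i), F.linearCombination_frameComb,
          single_one_dotProduct]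
        exact add_sub_cancel _ _
      · rw [coeffComb_conj hT hw hwh hL (F.extraComb_support _), F.linearCombination_extraComb,
          zero_dotProduct, add_zero, ← hIX s L hL, ← hIX s L' hL']
        exact hJ (IX s) (Or.inl (Or.inl (Or.inr ⟨e.symm s, by simp⟩)))
    · rw [(hIUF v).value_eq hT hw hwh hL]
      exact hJ (IU v) (Or.inr ⟨v, hv, rfl⟩)

end
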